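/- Let $M$ be a finite geometric lattice (atomistic and upper semimodular), with least element $\hat 0$ and greatest element $\hat 1$, let $\mathcal G\subseteq M_{>\hat 0}$ be a (combinatorial) building set: for every $x>\hat 0$, if $x_1,\dots,x_k$ are the maximal elements of $\mathcal G_{\le x}$, there is a poset isomorphism $\prod_i[\hat 0,x_i]\to[\hat 0,x]$ sending $(\hat 0,\dots,x_i,\dots,\hat 0)$ to $x_i$. Let $\mathcal H\subseteq\mathcal G$ be a partial building set, i.e. $\mathcal H$ contains all atoms of $M$ and $\mathcal H^\circ:=\mathcal H\setminus\mathrm{atoms}(M)$ is an upward-closed subset of $\mathcal G$. List $\mathcal H^\circ=\{p_1,\dots,p_m\}$ so that larger elements come first, and let $\mathcal L=\mathrm{Bl}_{p_m}\circ\cdots\circ\mathrm{Bl}_{p_1}(M)$. Here the combinatorial blowup of a finite meet-semilattice $L$ at $p\neq\hat 0$ is the poset $\mathrm{Bl}_p(L)=\{x\in L: x\not\ge p\}\cup\{(p,x): x\not\ge p,\ p\vee x\text{ exists in }L\}$, in which each of $y\ge x$, $(p,y)\ge (p,x)$, $(p,y)\ge x$ holds if and only if $y\ge x$ in $L$, and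 no $x$ lies above any $(p,y)$. The atoms of $\mathcal L$ are identified with $\mathcal H$, where $p_i$ stands for the atom $(p_i,\hat 0)$; for $y\in\mathcal L$ let $\mathrm{supp}(y)\subseteq\mathcal H$ be the set of atoms below $y$. Sheaves. A sheaf (of rational vector spaces) on a finite poset $P$, whose open sets are the downward-closed subsets, is a functor $F$ assigning to $x\in P$ a vector space $F(x)$, with restriction maps $F(y)\to F(x)$ for $x\le y$. Global sections are $\Gamma(F)=\varprojlim F$, and $H^q(P,-)=R^q\Gamma$. Let $\mathrm{Int}(\mathcal L)=\{(x,y)\in \mathcal L\times\mathcal L: x\le y\}$, ordered by $(x_0,y_0)\le(x_1,y_1)\iff x_0\le x_1\le y_1\le y_0$, with projections $\mathrm{pr}_1:\mathrm{Int}(\mathcal L)\to\mathcal L$, $\mathrm{pr}_2:\mathrm{Int}(\mathcal L)\to\mathcal L^{op}$, and the open embedding $\iota:\mathcal L^{op}\to\mathrm{Int}(\mathcal L)$, $\iota(y)=(\hat 0,y)$. Let $\iota_!$ denote extension by zero along $\iota$. The flag sheaves. For $x\in\mathcal L$ and $j\ge0$ let $\mathrm{Fl}^j(\mathcal L_{\le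 x})$ be the $\mathbb Q$-vector space spanned by chains $Y=(y_0<\dots<y_j)$ in $\mathcal L_{\le x}$ with $\mathrm{rank}\,y_k=k$, modulo, for every such $Y$ and every $0<k<j$, the sum of all chains obtained from $Y$ by replacing $y_k$ by some $y$ of rank $k$ with $y_{k-1}<y<y_{k+1}$. Let $\mathcal F^j$ be the sheaf on $\mathcal L$ with $\mathcal F^j(x)=\mathrm{Fl}^j(\mathcal L_{\le x})$, whose restriction maps for $x_0\le x_1$ send a chain in $\mathcal L_{\le x_1}$ to itself if it lies in $\mathcal L_{\le x_0}$ and to $0$ otherwise, and let $\delta:\mathcal F^j\to\mathcal F^{j+1}$ be given on stalks by $\delta(y_0<\dots<y_j)=(-1)^j\sum_{y_{j+1}}(y_0<\dots<y_j<y_{j+1})$, where $y_{j+1}$ runs over the elements of rank $j+1$ in $\mathcal L_{\le x}$ above $y_j$. The De Concini–Procesi sheaf. A set $S\subseteq\mathcal H$ is $\mathcal H$-nested if no antichain of at least two elements of $S$ has its join in $M$ contained in $\mathcal H$. For $y\in\mathcal L$ let $D_y=\mathbb Q[x_g: g\in\mathcal H]/J_y$, where $J_y$ is generated by the monomials $\prod_{g\in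 T}x_g$ for all $T\subseteq \mathcal H$ such that $\mathrm{supp}(y)\cup T$ is not $\mathcal H$-nested, and by $\sum_{h\in\mathcal H,\,h\ge g}x_h$ for all atoms $g$ of $M$; it is graded by $\deg x_g=2$. Let $\mathcal D$ be the graded sheaf on $\mathcal L^{op}$ with $\mathcal D(y)=D_y$ and with the canonical surjections $D_y\to D_z$ for $y\le z$ as restriction maps; let $\mathcal D^i$ be its part of degree $i$. Theorem. Let $r=\mathrm{rank}(M)$, let $\mathcal C^{\cdot,j}=\mathrm{pr}_1^*\mathcal F^j\otimes_{\mathbb Q}\mathrm{pr}_2^*\mathcal D$, with stalks $\mathcal C^{\cdot,j}(x,y)=\mathrm{Fl}^j(\mathcal L_{\le x})\otimes D_y$, and equip it with the differential $\delta\otimes\mathrm{pr}_2^*\mathcal D$. Let $\iota_!\mathcal D\to\mathcal C^{\cdot,0}$ be the map that sends $m$ in the stalk $D_y$ at $(\hat 0,y)$ to $(\hat 0)\otimes m$. Then $\mathcal C^{\cdot,j}=0$ for $j>r$, and $$0\to\iota_!\mathcal D\to\mathcal C^{\cdot,0}\xrightarrow{\ \delta\ }\mathcal C^{\cdot,1}\xrightarrow{\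 \delta\ }\cdots\xrightarrow{\ \delta\ }\mathcal C^{\cdot,r}\to0$$ is a $\Gamma$-acyclic resolution of $\iota_!\mathcal D$ on $\mathrm{Int}(\mathcal L)$: the sequence is exact, and $H^q(\mathrm{Int}(\mathcal L),\mathcal C^{\cdot,j})=0$ for all $j\ge0$ and $q>0$. The same holds in every degree $i$ of $\mathcal D$, that is, with $\mathcal D$ replaced by $\mathcal D^i$ and $\mathcal C^{\cdot,j}$ by $\mathcal C^{i,j}=\mathrm{pr}_1^*\mathcal F^j\otimes\mathrm{pr}_2^*\mathcal D^i$. -/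

import Mathlib

open CategoryTheory CategoryTheory.Limits Opposite TensorProduct

universe u

noncomputable section

/-! ## Sheaves on posets and their cohomology -/

/-- A sheaf of rational vector spaces on a poset `P`, where the open sets of `P` are the
downward-closed sets: a diagram assigning to `x` the sections (equivalently, the stalk) over the
principal order ideal of `x`, with restriction maps from `F y` to `F x` for `x ≤ y`. -/
abbrev PosetSheaf (P : Type u) [PartialOrder P] := Pᵒᵖ ⥤ ModuleCat.{u} ℚ

theorem enoughInjectives_discrete (ι : Type u) :
    EnoughInjectives (Discrete ι ⥤ ModuleCat.{u} ℚ) where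
  presentation F := by
    let I : Discrete ι ⥤ ModuleCat.{u} ℚ :=
      Discrete.functor fun i => Injective.under (F.obj ⟨i⟩)
    let f : F ⟶ I := Discrete.natTrans fun i => Injective.ι (F.obj i)
    have hm : Mono f := by
      have : ∀ i, Mono (f.app i) := fun ⟨i⟩ => by
        change Mono (Injective.ι (F.obj ⟨i⟩)); infer_instance
      exact NatTrans.mono_of_mono_app f
    have hI : Injective I := ⟨fun {X Y} g h _ => by
      refine ⟨Discrete.natTrans fun ⟨i⟩ =>
        (Injective.factorThru (J := Injective.under (F.obj ⟨i⟩)) (g.app ⟨i⟩) (h.app ⟨i⟩)), ?_⟩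
      ext ⟨i⟩ : 2
      exact Injective.comp_factorThru (J := Injective.under (F.obj ⟨i⟩)) _ _⟩
    exact ⟨⟨I, hI, f, hm⟩⟩

instance posetSheaf_enoughInjectives (P : Type u) [PartialOrder P] :
    EnoughInjectives (PosetSheaf P) := by
  have := enoughInjectives_discrete.{u} (Pᵒᵖ)
  let E : Discrete Pᵒᵖ ⥤ Pᵒᵖ := Discrete.functor id
  let W := (Functor.whiskeringLeft _ _ (ModuleCat.{u} ℚ)).obj E
  have : W.Faithful := ⟨fun {X Y f g} h => by
    ext x : 2
    exact congrArg (fun t => t.app ⟨x⟩) h⟩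
  have : W.PreservesMonomorphisms := ⟨fun f _ => by
    have : ∀ i, Mono ((W.map f).app i) := fun ⟨i⟩ => by
      change Mono (f.app i); infer_instance
    exact NatTrans.mono_of_mono_app _⟩
  exact EnoughInjectives.of_adjunction (E.ranAdjunction (ModuleCat.{u} ℚ))

/-- The global sections functor `Γ`: the limit of the diagram over the whole poset. -/
abbrev globalSections (P : Type u) [PartialOrder P] : PosetSheaf P ⥤ ModuleCat.{u} ℚ := lim

instance globalSections_additive (P : Type u) [PartialOrder P] : (globalSections P).Additive :=
  ⟨by intros; apply limit.hom_ext; intro j; simp⟩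

/-- Sheaf cohomology `H^q(P, F)`: the `q`-th right derived functor of global sections. -/
def sheafCohomology {P : Type u} [PartialOrder P] (q : ℕ) (F : PosetSheaf P) : ModuleCat.{u} ℚ :=
  ((globalSections P).rightDerived q).obj F

/-- Inverse image of a sheaf along an order-preserving map. -/
abbrev sheafPullback {P Q : Type u} [PartialOrder P] [PartialOrder Q] (f : P →o Q)
    (F : PosetSheaf Q) : PosetSheaf P :=
  f.monotone.functor.op ⋙ F

/-- The tensor product over `ℚ` of two sheaves, computed stalkwise. -/
def tensorSheaf {P : Type u} [PartialOrder P] (F G : PosetSheaf P) : PosetSheaf P where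
  obj X := ModuleCat.of ℚ (F.obj X ⊗[ℚ] G.obj X)
  map f := ModuleCat.ofHom (TensorProduct.map (F.map f).hom (G.map f).hom)
  map_id X := by
    ext1
    simp
  map_comp f g := by
    ext1
    simp [TensorProduct.map_comp]

/-- The map of sheaves `φ ⊗ G` induced by `φ : F ⟶ F'`. -/
def tensorSheafMap {P : Type u} [PartialOrder P] {F F' : PosetSheaf P} (φ : F ⟶ F')
    (G : PosetSheaf P) : tensorSheaf F G ⟶ tensorSheaf F' G where
  app X := ModuleCat.ofHom (TensorProduct.map (φ.app X).hom LinearMap.id)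
  naturality X Y f := by
    ext1
    change TensorProduct.map _ _ ∘ₗ TensorProduct.map _ _ =
      TensorProduct.map _ _ ∘ₗ TensorProduct.map _ _
    rw [← TensorProduct.map_comp, ← TensorProduct.map_comp, LinearMap.id_comp, LinearMap.comp_id]
    have := congrArg ModuleCat.Hom.hom (φ.naturality f)
    simp only [ModuleCat.hom_comp] at this
    rw [this]

/-- A cochain complex of sheaves `K`, together with an augmentation `ε : G ⟶ K⁰`, is a
`Γ`-acyclic resolution of `G`: the augmented complex `0 → G → K⁰ → K¹ → ⋯` is exact, and every
`Kʲ` has vanishing cohomology in positive degrees. -/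
structure IsGammaAcyclicResolution {P : Type u} [PartialOrder P] (G : PosetSheaf P)
    (K : CochainComplex (PosetSheaf P) ℕ) (ε : G ⟶ K.X 0) : Prop where
  comp_eq_zero : ε ≫ K.d 0 1 = 0
  mono : Mono ε
  exact_zero : (ShortComplex.mk ε (K.d 0 1) comp_eq_zero).Exact
  exact_succ : ∀ j : ℕ, K.ExactAt (j + 1)
  acyclic : ∀ j q : ℕ, 0 < q → IsZero (sheafCohomology q (K.X j))

/-! ## The poset of intervals -/

/-- The poset of intervals of `P`: pairs `(x, y)` with `x ≤ y`, where
`(x₀, y₀) ≤ (x₁, y₁)` if and only if `x₀ ≤ x₁ ≤ y₁ ≤ y₀`. -/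
def IntervalPoset (P : Type u) [PartialOrder P] : Type u :=
  {z : P × Pᵒᵈ // z.1 ≤ OrderDual.ofDual z.2}

instance IntervalPoset.partialOrder (P : Type u) [PartialOrder P] :
    PartialOrder (IntervalPoset P) :=
  inferInstanceAs (PartialOrder {z : P × Pᵒᵈ // z.1 ≤ OrderDual.ofDual z.2})

/-- The projection `(x, y) ↦ x`. -/
def IntervalPoset.pr₁ (P : Type u) [PartialOrder P] : IntervalPoset P →o P :=
  ⟨fun z => z.1.1, fun _ _ h => h.1⟩

/-- The projection `(x, y) ↦ y` to the opposite poset. -/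
def IntervalPoset.pr₂ (P : Type u) [PartialOrder P] : IntervalPoset P →o Pᵒᵈ :=
  ⟨fun z => z.1.2, fun _ _ h => h.2⟩

/-- The inclusion `y ↦ (⊥, y)` of the opposite poset. Its image is an open subset. -/
def IntervalPoset.ι (P : Type u) [PartialOrder P] [OrderBot P] : Pᵒᵈ →o IntervalPoset P :=
  ⟨fun y => ⟨(⊥, y), bot_le⟩, fun _ _ h => ⟨le_rfl, h⟩⟩

open Classical in
/-- For a linear map `φ : V → W` and propositions `p`, `q`: the map from `V` (if `p` holds, zero
otherwise) to `W` (if `q` holds, zero otherwise) that is `φ` if `p` and `q` hold, and zero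
otherwise. The space "`V` if `p` holds, zero otherwise" is written as the space of functions to `V`
from the type of proofs of `p`, which has one element if `p` holds and none otherwise. -/
def supportedMap {V W : Type u} [AddCommGroup V] [Module ℚ V] [AddCommGroup W] [Module ℚ W]
    (p q : Prop) (φ : V →ₗ[ℚ] W) : (PLift p → V) →ₗ[ℚ] (PLift q → W) :=
  LinearMap.pi fun _ => if h : p then φ ∘ₗ LinearMap.proj ⟨h⟩ else 0

theorem supportedMap_pos {V W : Type u} [AddCommGroup V] [Module ℚ V] [AddCommGroup W]
    [Module ℚ W] {p q : Prop} (φ : V →ₗ[ℚ] W) (h : p) (m : PLift p → V) (t : PLift q) :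
    supportedMap p q φ m t = φ (m ⟨h⟩) := by
  simp [supportedMap, h]

theorem supportedMap_neg {V W : Type u} [AddCommGroup V] [Module ℚ V] [AddCommGroup W]
    [Module ℚ W] {p q : Prop} (φ : V →ₗ[ℚ] W) (h : ¬ p) : supportedMap p q φ = 0 := by
  ext m t
  simp [supportedMap, h]

/-- Extension by zero `ι_!` along the open embedding `ι`, `y ↦ (⊥, y)`. The stalk at `(x, y)` is
`G y` if `x = ⊥`, and zero otherwise. The restriction maps are those of `G` over the image of `ι`,
and zero elsewhere. -/
def extendByZero {P : Type u} [PartialOrder P] [OrderBot P] (G : PosetSheaf Pᵒᵈ) :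
    PosetSheaf (IntervalPoset P) where
  obj Z := ModuleCat.of ℚ
    (PLift (IntervalPoset.pr₁ P Z.unop = ⊥) → (sheafPullback (IntervalPoset.pr₂ P) G).obj Z)
  map f := ModuleCat.ofHom
    (supportedMap _ _ ((sheafPullback (IntervalPoset.pr₂ P) G).map f).hom)
  map_id Z := by
    ext1
    refine LinearMap.ext fun m => funext fun h => ?_
    refine (supportedMap_pos _ h.down _ _).trans ?_
    rw [CategoryTheory.Functor.map_id]
    rfl
  map_comp {Z W V} f g := by
    ext1
    refine LinearMap.ext fun m => funext fun hV => ?_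
    rw [Functor.map_comp]
    change supportedMap _ _ _ m hV = supportedMap _ _ _ (supportedMap _ _ _ m) hV
    by_cases hZ : IntervalPoset.pr₁ P Z.unop = ⊥
    · have hW : IntervalPoset.pr₁ P W.unop = ⊥ :=
        le_bot_iff.1 (hZ ▸ (IntervalPoset.pr₁ P).monotone f.unop.le)
      rw [supportedMap_pos _ hW, supportedMap_pos _ hZ, supportedMap_pos _ hZ]
      rfl
    · rw [supportedMap_neg _ hZ, supportedMap_neg _ hZ, LinearMap.zero_apply,
        LinearMap.zero_apply, map_zero]

/-! ## The flag complex -/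

section Flags

variable {P : Type u} [PartialOrder P]

/-- A flag of length `j` in `P_{≤ x}`: a chain `y₀ < y₁ < ⋯ < y_j ≤ x` with `y_k` of rank `k`.
The rank of an element is the maximal length of a chain descending from it; since `P_{≤ x}` is
downward closed, ranks in `P_{≤ x}` and in `P` agree. -/
@[ext] structure RankedFlag (x : P) (j : ℕ) : Type u where
  elt : Fin (j + 1) → P
  strictMono : StrictMono elt
  rank_eq : ∀ k, Order.height (elt k) = (k : ℕ)
  le : elt (Fin.last j) ≤ x

variable [Finite P]

instance RankedFlag.finite (x : P) (j : ℕ) : Finite (RankedFlag x j) :=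
  Finite.of_injective (fun Y => Y.elt) fun _ _ h => RankedFlag.ext h

instance RankedFlag.fintype (x : P) (j : ℕ) : Fintype (RankedFlag x j) := Fintype.ofFinite _

open Classical in
/-- The sum of all flags `Y` of length `j` in `P_{≤ x}` satisfying `p`. -/
def flagSum (x : P) (j : ℕ) (p : (Fin (j + 1) → P) → Prop) : RankedFlag x j →₀ ℚ :=
  ∑ Y : RankedFlag x j with p Y.elt, Finsupp.single Y 1

/-- The relations of the flag space: for every flag `Y` and every `0 < k < j`, the sum of all the
flags obtained from `Y` by replacing `y_k` by an element `y` of rank `k` with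
`y_{k-1} < y < y_{k+1}`. -/
def flagRelations (x : P) (j : ℕ) : Submodule ℚ (RankedFlag x j →₀ ℚ) :=
  Submodule.span ℚ {v | ∃ (Y : RankedFlag x j) (k : Fin (j + 1)), 0 < k ∧ k < Fin.last j ∧
    v = flagSum x j fun z => ∀ l, l ≠ k → z l = Y.elt l}

/-- The flag space `Fl^j(P_{≤ x})`. -/
abbrev FlagSpace (x : P) (j : ℕ) : Type u := (RankedFlag x j →₀ ℚ) ⧸ flagRelations x j

theorem flagSum_mem {x : P} {j : ℕ} (p : (Fin (j + 1) → P) → Prop) (k : Fin (j + 1))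
    (h0 : 0 < k) (hk : k < Fin.last j)
    (hp : ∀ z z' : Fin (j + 1) → P, (∀ l, l ≠ k → z l = z' l) → p z → p z') :
    flagSum x j p ∈ flagRelations x j := by
  classical
  let R : Setoid (RankedFlag x j) :=
    { r := fun Y Z => ∀ l, l ≠ k → Y.elt l = Z.elt l
      iseqv := ⟨fun _ _ _ => rfl, fun h l hl => (h l hl).symm,
        fun h h' l hl => (h l hl).trans (h' l hl)⟩ }
  unfold flagSum
  rw [Finset.sum_partition R]
  refine Submodule.sum_mem _ fun c hc => ?_
  obtain ⟨Y, hY, rfl⟩ := Finset.mem_image.1 hc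
  refine Submodule.subset_span ⟨Y, k, h0, hk, ?_⟩
  unfold flagSum
  refine Finset.sum_congr ?_ fun _ _ => rfl
  ext Z
  simp only [Finset.mem_filter, Finset.mem_univ, true_and]
  constructor
  · rintro ⟨_, h⟩
    exact Quotient.exact h
  · intro h
    exact ⟨hp _ _ (fun l hl => (h l hl).symm) (Finset.mem_filter.1 hY).2, Quotient.sound h⟩

open Classical in
/-- The restriction map on flags, for `x₀ ≤ x₁`: a flag in `P_{≤ x₁}` is sent to itself if it
lies in `P_{≤ x₀}`, and to zero otherwise. -/
def flagRestrictAux (x₁ x₀ : P) (j : ℕ) : (RankedFlag x₁ j →₀ ℚ) →ₗ[ℚ] (RankedFlag x₀ j →₀ ℚ) :=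
  Finsupp.linearCombination ℚ fun Y =>
    if h : Y.elt (Fin.last j) ≤ x₀ then
      Finsupp.single (⟨Y.elt, Y.strictMono, Y.rank_eq, h⟩ : RankedFlag x₀ j) 1
    else 0

theorem flagRestrictAux_flagSum {x₁ x₀ : P} (hx : x₀ ≤ x₁) (j : ℕ)
    (p : (Fin (j + 1) → P) → Prop) :
    flagRestrictAux x₁ x₀ j (flagSum x₁ j p) = flagSum x₀ j p := by
  classical
  unfold flagSum flagRestrictAux
  simp only [map_sum, Finsupp.linearCombination_single, one_smul]
  rw [← Finset.sum_filter_add_sum_filter_not _ (fun Y => Y.elt (Fin.last j) ≤ x₀)]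
  rw [add_eq_left.2 (Finset.sum_eq_zero fun Y hY => dif_neg (Finset.mem_filter.1 hY).2)]
  refine Finset.sum_bij'
    (fun Y hY => (⟨Y.elt, Y.strictMono, Y.rank_eq, (Finset.mem_filter.1 hY).2⟩ : RankedFlag x₀ j))
    (fun Y _ => (⟨Y.elt, Y.strictMono, Y.rank_eq, Y.le.trans hx⟩ : RankedFlag x₁ j))
    ?_ ?_ ?_ ?_ ?_
  · intro Y hY
    simpa using (Finset.mem_filter.1 (Finset.mem_filter.1 hY).1).2
  · intro Y hY
    simpa using ⟨(Finset.mem_filter.1 hY).2, Y.le⟩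
  · intro Y hY
    rfl
  · intro Y hY
    rfl
  · intro Y hY
    rw [dif_pos (Finset.mem_filter.1 hY).2]

theorem flagRestrictAux_single {x₁ x₀ : P} (hx : x₀ ≤ x₁) (j : ℕ) (Y : RankedFlag x₁ j) :
    flagRestrictAux x₁ x₀ j (Finsupp.single Y 1) = flagSum x₀ j fun z => z = Y.elt := by
  rw [← flagRestrictAux_flagSum hx]
  congr 1
  unfold flagSum
  rw [Finset.sum_eq_single_of_mem Y (by simp)]
  intro Z hZ hne
  exact absurd (RankedFlag.ext (by simpa using hZ)) hne

/-- The restriction map `Fl^j(P_{≤ x₁}) → Fl^j(P_{≤ x₀})` for `x₀ ≤ x₁`. -/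
def flagRestrict {x₁ x₀ : P} (hx : x₀ ≤ x₁) (j : ℕ) : FlagSpace x₁ j →ₗ[ℚ] FlagSpace x₀ j :=
  Submodule.mapQ _ _ (flagRestrictAux x₁ x₀ j) <| by
    refine Submodule.span_le.2 ?_
    rintro _ ⟨Y, k, h0, hk, rfl⟩
    change flagRestrictAux x₁ x₀ j _ ∈ flagRelations x₀ j
    rw [flagRestrictAux_flagSum hx]
    exact flagSum_mem _ k h0 hk fun z z' h hz l hl => (h l hl).symm.trans (hz l hl)

/-- The flag differential on flags:
`δ(y₀ < ⋯ < y_j) = (-1)^j ∑ (y₀ < ⋯ < y_j < y_{j+1})`, the sum over all `y_{j+1} > y_j` of rank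
`j + 1` in `P_{≤ x}`. -/
def flagDiffAux (x : P) (j : ℕ) : (RankedFlag x j →₀ ℚ) →ₗ[ℚ] (RankedFlag x (j + 1) →₀ ℚ) :=
  Finsupp.linearCombination ℚ fun Y =>
    (-1 : ℚ) ^ j • flagSum x (j + 1) fun z => ∀ l : Fin (j + 1), z l.castSucc = Y.elt l

/-- The truncation of a flag by its top element. -/
def RankedFlag.truncate {x : P} {j : ℕ} (Y : RankedFlag x (j + 1)) : RankedFlag x j where
  elt l := Y.elt l.castSucc
  strictMono _ _ h := Y.strictMono (Fin.castSucc_lt_castSucc_iff.2 h)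
  rank_eq k := by simpa using Y.rank_eq k.castSucc
  le := (Y.strictMono.monotone (Fin.le_last _)).trans Y.le

theorem flagDiffAux_flagSum (x : P) (j : ℕ) (p : (Fin (j + 1) → P) → Prop) :
    flagDiffAux x j (flagSum x j p) =
      (-1 : ℚ) ^ j • flagSum x (j + 1) fun z => p fun l => z l.castSucc := by
  classical
  unfold flagDiffAux
  conv_lhs => rw [flagSum]
  simp only [map_sum, Finsupp.linearCombination_single, one_smul]
  rw [← Finset.smul_sum]
  congr 1
  unfold flagSum
  rw [← Finset.sum_fiberwise_of_maps_to
    (s := Finset.univ.filter fun W : RankedFlag x (j + 1) => p fun l => W.elt l.castSucc)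
    (t := Finset.univ.filter fun Y : RankedFlag x j => p Y.elt) (g := RankedFlag.truncate)
    (fun W hW => by simpa [RankedFlag.truncate] using hW)]
  refine Finset.sum_congr rfl fun Y hY => Finset.sum_congr ?_ fun _ _ => rfl
  ext W
  simp only [Finset.mem_filter, Finset.mem_univ, true_and]
  constructor
  · intro h
    have hW : W.truncate = Y := RankedFlag.ext (funext h)
    refine ⟨?_, hW⟩
    have := (Finset.mem_filter.1 hY).2
    rw [← hW] at this
    exact this
  · rintro ⟨_, rfl⟩ l
    rfl

/-- The flag differential `δ : Fl^j(P_{≤ x}) → Fl^{j+1}(P_{≤ x})`. -/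
def flagDiff (x : P) (j : ℕ) : FlagSpace x j →ₗ[ℚ] FlagSpace x (j + 1) :=
  Submodule.mapQ _ _ (flagDiffAux x j) <| by
    refine Submodule.span_le.2 ?_
    rintro _ ⟨Y, k, h0, hk, rfl⟩
    change flagDiffAux x j _ ∈ flagRelations x (j + 1)
    rw [flagDiffAux_flagSum]
    refine Submodule.smul_mem _ _ (flagSum_mem _ k.castSucc ?_ (Fin.castSucc_lt_last k) ?_)
    · exact Fin.castSucc_pos_iff.2 h0
    · intro z z' h hz l hl
      exact (h l.castSucc fun e => hl (Fin.castSucc_injective _ e)).symm.trans (hz l hl)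

theorem flagDiff_comp (x : P) (j : ℕ) : flagDiff x (j + 1) ∘ₗ flagDiff x j = 0 := by
  refine Submodule.linearMap_qext _ (Finsupp.lhom_ext' fun Y => LinearMap.ext_ring ?_)
  change Submodule.Quotient.mk (flagDiffAux x (j + 1) (flagDiffAux x j (Finsupp.single Y 1))) = _
  have h1 : flagDiffAux x j (Finsupp.single Y 1) =
      (-1 : ℚ) ^ j • flagSum x (j + 1) fun z => ∀ l : Fin (j + 1), z l.castSucc = Y.elt l := by
    simp [flagDiffAux]
  rw [h1, map_smul, flagDiffAux_flagSum]
  refine (Submodule.Quotient.mk_eq_zero _).2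
    (Submodule.smul_mem _ _ (Submodule.smul_mem _ _
      (flagSum_mem _ (Fin.last (j + 1)).castSucc ?_ (Fin.castSucc_lt_last _) ?_)))
  · exact Fin.castSucc_pos_iff.2 (Fin.last_pos)
  · intro z z' h hz l
    exact (h l.castSucc.castSucc fun e =>
      (Fin.castSucc_lt_last l).ne (Fin.castSucc_injective _ e)).symm.trans (hz l)

theorem flagDiff_restrict {x₁ x₀ : P} (hx : x₀ ≤ x₁) (j : ℕ) :
    flagDiff x₀ j ∘ₗ flagRestrict hx j = flagRestrict hx (j + 1) ∘ₗ flagDiff x₁ j := by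
  refine Submodule.linearMap_qext _ (Finsupp.lhom_ext' fun Y => LinearMap.ext_ring ?_)
  change Submodule.Quotient.mk (flagDiffAux x₀ j (flagRestrictAux x₁ x₀ j (Finsupp.single Y 1))) =
    Submodule.Quotient.mk (flagRestrictAux x₁ x₀ (j + 1) (flagDiffAux x₁ j (Finsupp.single Y 1)))
  have h1 : flagDiffAux x₁ j (Finsupp.single Y 1) =
      (-1 : ℚ) ^ j • flagSum x₁ (j + 1) fun z => ∀ l : Fin (j + 1), z l.castSucc = Y.elt l := by
    simp [flagDiffAux]
  rw [h1, map_smul, flagRestrictAux_flagSum hx, flagRestrictAux_single hx, flagDiffAux_flagSum]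
  simp only [funext_iff]

theorem flagRestrict_id (x : P) (j : ℕ) : flagRestrict (le_refl x) j = LinearMap.id := by
  classical
  refine Submodule.linearMap_qext _ (Finsupp.lhom_ext' fun Y => LinearMap.ext_ring ?_)
  change Submodule.Quotient.mk (flagRestrictAux x x j (Finsupp.single Y 1)) =
    Submodule.Quotient.mk (Finsupp.single Y 1)
  simp [flagRestrictAux, Y.le]

theorem flagRestrict_comp {x₂ x₁ x₀ : P} (h₁ : x₁ ≤ x₂) (h₀ : x₀ ≤ x₁) (j : ℕ) :
    flagRestrict h₀ j ∘ₗ flagRestrict h₁ j = flagRestrict (h₀.trans h₁) j := by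
  refine Submodule.linearMap_qext _ (Finsupp.lhom_ext' fun Y => LinearMap.ext_ring ?_)
  change Submodule.Quotient.mk (flagRestrictAux x₁ x₀ j
      (flagRestrictAux x₂ x₁ j (Finsupp.single Y 1))) =
    Submodule.Quotient.mk (flagRestrictAux x₂ x₀ j (Finsupp.single Y 1))
  rw [flagRestrictAux_single h₁, flagRestrictAux_flagSum h₀,
    flagRestrictAux_single (h₀.trans h₁)]

variable (P)

/-- The sheaf `F^j` on `P` with `F^j(x) = Fl^j(P_{≤ x})`. -/
def flagSheaf (j : ℕ) : PosetSheaf P where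
  obj X := ModuleCat.of ℚ (FlagSpace X.unop j)
  map f := ModuleCat.ofHom (flagRestrict f.unop.le j)
  map_id X := by
    ext1
    exact flagRestrict_id _ _
  map_comp f g := by
    ext1
    exact (flagRestrict_comp f.unop.le g.unop.le j).symm

/-- The differential `δ : F^j ⟶ F^{j+1}` of the flag sheaves. -/
def flagSheafDiff (j : ℕ) : flagSheaf P j ⟶ flagSheaf P (j + 1) where
  app X := ModuleCat.ofHom (flagDiff X.unop j)
  naturality X Y f := by
    ext1
    exact flagDiff_restrict f.unop.le j

/-- The cochain complex of sheaves `pr₁^* F ⊗ pr₂^* G` on the poset of intervals of `P`, for a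
sheaf `G` on the opposite of `P`, with differential `δ ⊗ pr₂^* G`. -/
def flagTensorComplex (G : PosetSheaf Pᵒᵈ) :
    CochainComplex (PosetSheaf (IntervalPoset P)) ℕ :=
  CochainComplex.of
    (fun j => tensorSheaf (sheafPullback (IntervalPoset.pr₁ P) (flagSheaf P j))
      (sheafPullback (IntervalPoset.pr₂ P) G))
    (fun j => tensorSheafMap
      (Functor.whiskerLeft (IntervalPoset.pr₁ P).monotone.functor.op (flagSheafDiff P j))
      (sheafPullback (IntervalPoset.pr₂ P) G))
    (fun j => by
      ext Z : 2
      ext1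
      change TensorProduct.map _ _ ∘ₗ TensorProduct.map _ _ = 0
      rw [← TensorProduct.map_comp]
      erw [flagDiff_comp]
      exact TensorProduct.map_zero_left _)

variable {P}

/-- The class of the flag `(⊥)` of length zero in `Fl^0(P_{≤ x})`. -/
def botFlag [OrderBot P] (x : P) : FlagSpace x 0 :=
  Submodule.Quotient.mk (Finsupp.single
    { elt := fun _ => ⊥
      strictMono := fun a b h => absurd h (by simp [Fin.fin_one_eq_zero])
      rank_eq := fun k => by simp
      le := bot_le } 1)

theorem flagRestrict_botFlag [OrderBot P] {x₁ x₀ : P} (hx : x₀ ≤ x₁) :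
    flagRestrict hx 0 (botFlag x₁) = botFlag x₀ := by
  classical
  change Submodule.Quotient.mk (flagRestrictAux x₁ x₀ 0 _) = _
  simp [flagRestrictAux, botFlag]

open Classical in
/-- The map from `V` (if `x = ⊥`, zero otherwise) to `Fl^0(P_{≤ x}) ⊗ V` that sends `m` to
`(⊥) ⊗ m` if `x = ⊥`. -/
def augmentationStalk [OrderBot P] (x : P) (V : Type u) [AddCommGroup V] [Module ℚ V] :
    (PLift (x = ⊥) → V) →ₗ[ℚ] FlagSpace x 0 ⊗[ℚ] V :=
  if h : x = ⊥ then TensorProduct.mk ℚ _ _ (botFlag x) ∘ₗ LinearMap.proj ⟨h⟩ else 0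

theorem augmentationStalk_pos [OrderBot P] {x : P} (V : Type u) [AddCommGroup V] [Module ℚ V]
    (h : x = ⊥) (m : PLift (x = ⊥) → V) : augmentationStalk x V m = botFlag x ⊗ₜ m ⟨h⟩ := by
  simp [augmentationStalk, h]

theorem augmentationStalk_neg [OrderBot P] {x : P} (V : Type u) [AddCommGroup V] [Module ℚ V]
    (h : ¬ x = ⊥) : augmentationStalk x V = 0 := by
  simp [augmentationStalk, h]

theorem augmentationStalk_natural [OrderBot P] {x₁ x₀ : P} (hx : x₀ ≤ x₁) {V W : Type u}
    [AddCommGroup V] [Module ℚ V] [AddCommGroup W] [Module ℚ W] (φ : V →ₗ[ℚ] W)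
    (m : PLift (x₁ = ⊥) → V) :
    augmentationStalk x₀ W (supportedMap _ _ φ m) =
      TensorProduct.map (flagRestrict hx 0) φ (augmentationStalk x₁ V m) := by
  by_cases h₁ : x₁ = ⊥
  · have h₀ : x₀ = ⊥ := le_bot_iff.1 (h₁ ▸ hx)
    rw [augmentationStalk_pos _ h₀, augmentationStalk_pos _ h₁, supportedMap_pos _ h₁,
      TensorProduct.map_tmul, flagRestrict_botFlag]
  · rw [augmentationStalk_neg _ h₁, supportedMap_neg _ h₁, LinearMap.zero_apply,
      LinearMap.zero_apply, map_zero, map_zero]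

/-- The augmentation `ι_! G ⟶ pr₁^* F⁰ ⊗ pr₂^* G`: on the stalk at `(⊥, y)` it sends `m` to
`(⊥) ⊗ m`. -/
def augmentation [OrderBot P] (G : PosetSheaf Pᵒᵈ) :
    extendByZero G ⟶ (flagTensorComplex P G).X 0 where
  app Z := ModuleCat.ofHom
    (augmentationStalk (IntervalPoset.pr₁ P Z.unop) ((sheafPullback (IntervalPoset.pr₂ P) G).obj Z))
  naturality Z W f := by
    ext1
    exact LinearMap.ext fun m => augmentationStalk_natural
      ((IntervalPoset.pr₁ P).monotone f.unop.le) _ m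

end Flags

/-! ## Combinatorial blowups -/

/-- The combinatorial blowup `Bl_p(L)`. Its elements are the `x ∈ L` with `x ≱ p`, and the pairs
`(p, x)` with `x ≱ p` such that the join `p ∨ x` exists in `L`. -/
inductive Blowup (L : Type u) [PartialOrder L] (p : L) : Type u
  | old (x : L) (hx : ¬ p ≤ x) : Blowup L p
  | new (x : L) (hx : ¬ p ≤ x) (hj : ∃ z, IsLUB {p, x} z) : Blowup L p

namespace Blowup

variable {L : Type u} [PartialOrder L] {p : L}

/-- The order relation of the blowup: `(p, y) ≥ (p, x)`, `(p, y) ≥ x` and `y ≥ x` in `Bl_p(L)`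
each hold if and only if `y ≥ x` in `L`, while an element `x` is never above a pair `(p, y)`. -/
protected def le : Blowup L p → Blowup L p → Prop
  | old x _, old y _ => x ≤ y
  | old x _, new y _ _ => x ≤ y
  | new x _ _, new y _ _ => x ≤ y
  | new _ _ _, old _ _ => False

instance : PartialOrder (Blowup L p) where
  le := Blowup.le
  le_refl a := by
    cases a <;> exact le_refl _
  le_trans a b c h h' := by
    cases a <;> cases b <;> cases c <;>
      first
        | exact h.elim
        | exact h'.elim
        | exact le_trans (α := L) h h'
  le_antisymm a b h h' := by
    cases a <;> cases b <;>
      first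
        | exact h.elim
        | exact h'.elim
        | (obtain rfl := le_antisymm (α := L) h h'; rfl)

instance [Finite L] : Finite (Blowup L p) :=
  Finite.of_injective
    (fun a : Blowup L p => match a with
      | old x _ => (Sum.inl x : L ⊕ L)
      | new x _ _ => Sum.inr x)
    (by
      intro a b h
      cases a <;> cases b <;> simp_all)

variable [OrderBot L]

/-- The bottom element of the blowup at `p ≠ ⊥`. -/
@[reducible] def orderBot (hp : p ≠ ⊥) : OrderBot (Blowup L p) where
  bot := old ⊥ fun h => hp (le_bot_iff.1 h)
  bot_le a := by
    cases a
    · exact bot_le (α := L)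
    · exact bot_le (α := L)

/-- The new atom `(p, ⊥)` of the blowup at `p ≠ ⊥`. -/
def newAtom (hp : p ≠ ⊥) : Blowup L p :=
  new ⊥ (fun h => hp (le_bot_iff.1 h))
    ⟨p, by simp only [IsLUB, upperBounds_insert, upperBounds_singleton]
           refine ⟨⟨le_refl p, bot_le⟩, fun z hz => hz.1⟩⟩

end Blowup

/-- A stage in a sequence of blowups of `M`: a finite poset with least element, together with
the element of that poset (if there is one) that is denoted by the same symbol as `x ∈ M`. -/
structure BlowupStage (M : Type u) where
  carrier : Type u
  [partialOrder : PartialOrder carrier]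
  [orderBot : OrderBot carrier]
  [finite : Finite carrier]
  elt : M → Option carrier

attribute [instance] BlowupStage.partialOrder BlowupStage.orderBot BlowupStage.finite

namespace BlowupStage

variable (M : Type u) [PartialOrder M] [OrderBot M] [Finite M]

/-- The initial stage, `M` itself. -/
def initial : BlowupStage M where
  carrier := M
  elt := some

variable {M}

open Classical in
/-- The blowup of a stage `S` at the element `p` of `S` denoted by `q ∈ M`. In the blowup `q`
denotes the new atom `(p, ⊥)`, and every other symbol keeps its meaning as long as the element
it denotes survives. (If `q` denotes no element of `S`, or the least one, nothing is done;
this does not happen for the sequences of blowups considered below.) -/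
def blowup (S : BlowupStage M) (q : M) : BlowupStage M :=
  match S.elt q with
  | none => S
  | some p =>
    if hp : p = ⊥ then S else
      { carrier := Blowup S.carrier p
        orderBot := Blowup.orderBot hp
        elt := fun x =>
          if x = q then some (Blowup.newAtom hp)
          else (S.elt x).bind fun z => if hz : p ≤ z then none else some (Blowup.old z hz) }

/-- The iterated blowup `Bl_{p_m} ∘ ⋯ ∘ Bl_{p_1}(M)` for the list `[p_1, …, p_m]`. -/
def iterated (l : List M) : BlowupStage M := l.foldl blowup (initial M)

end BlowupStage

/-! ## Building sets and nested sets -/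

/-- The set of factors `max G_{≤ x}`: the maximal elements of `G` below `x`. -/
def factors {L : Type u} [PartialOrder L] (G : Set L) (x : L) : Set L :=
  {g | Maximal (fun h => h ∈ G ∧ h ≤ x) g}

open Classical in
/-- `G ⊆ L_{> ⊥}` is a building set: for all `x > ⊥` there is an isomorphism of posets from the
product of the intervals `[⊥, g]` over the factors `g` of `x` to `[⊥, x]`, which sends
`(⊥, …, g, …, ⊥)` to `g`. -/
def IsBuildingSet {L : Type u} [PartialOrder L] [OrderBot L] (G : Set L) : Prop :=
  (∀ g ∈ G, g ≠ ⊥) ∧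
  ∀ x : L, x ≠ ⊥ → ∃ φ : (∀ g : factors G x, Set.Iic (g : L)) ≃o Set.Iic x,
    ∀ g : factors G x,
      (φ (Function.update (fun g => (⟨⊥, bot_le⟩ : Set.Iic (g : L))) g ⟨g, le_refl _⟩) : L) = g

/-- `H ⊆ G` is a partial building set: it contains all atoms, and its set of non-atoms is an
upward-closed subset of `G`. -/
def IsPartialBuildingSet {L : Type u} [PartialOrder L] [OrderBot L] (G H : Set L) : Prop :=
  H ⊆ G ∧ {a | IsAtom a} ⊆ H ∧
    ∀ p ∈ H \ {a | IsAtom a}, ∀ q ∈ G, p ≤ q → q ∈ H \ {a | IsAtom a}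

/-- The list `l` enumerates the non-atoms of `H` without repetition, in a reverse linear
extension of the order: if `p > q`, then `p` comes before `q`. -/
def IsBlowupOrder {L : Type u} [PartialOrder L] [OrderBot L] (H : Set L) (l : List L) : Prop :=
  (∀ p, p ∈ l ↔ p ∈ H \ {a | IsAtom a}) ∧ l.Nodup ∧ l.Pairwise fun p q => ¬ p < q

section DeConciniProcesi

variable {M : Type u} [Lattice M] [BoundedOrder M]

/-- A set `S ⊆ H` is `H`-nested if no antichain of at least two elements of `S` has its join (in
the lattice `M`) in `H`. -/
def IsNested (H : Set M) (S : Set M) : Prop :=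
  S ⊆ H ∧ ∀ T : Finset M, (T : Set M) ⊆ S → 2 ≤ T.card → IsAntichain (· ≤ ·) (T : Set M) →
    T.sup id ∉ H

theorem IsNested.mono {H S S' : Set M} (h : IsNested H S) (hS : S' ⊆ S) : IsNested H S' :=
  ⟨hS.trans h.1, fun T hT => h.2 T (hT.trans hS)⟩

variable [Finite M]

/-- The support of an element `y` of a blowup: the set of all `h ∈ H` for which the atom of the
blowup denoted by `h` lies below `y`. -/
def supp (H : Set M) (L : BlowupStage M) (y : L.carrier) : Set M :=
  {h | h ∈ H ∧ ∃ a, L.elt h = some a ∧ a ≤ y}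

/-- The linear form `c_g`, the sum of all `x_h` with `h ∈ H` and `g ≤ h`. -/
def linearForm (H : Set M) (g : M) : MvPolynomial H ℚ :=
  ∑ h ∈ (Set.toFinite {h : H | g ≤ h}).toFinset, MvPolynomial.X h

/-- The ideal `J_y(H)`, generated by the monomials `x_T` for which `S ∪ T` is not nested, and by
the linear forms `c_g` for all atoms `g`. Here `S` is a nested set with join `y`, and we choose the
support of `y`. -/
def dpIdeal (H : Set M) (L : BlowupStage M) (y : L.carrier) : Ideal (MvPolynomial H ℚ) :=
  Ideal.span
    ({m | ∃ T : Finset H, ¬ IsNested H (supp H L y ∪ Subtype.val '' (T : Set H)) ∧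
        m = ∏ g ∈ T, MvPolynomial.X g} ∪
      {m | ∃ g : M, IsAtom g ∧ m = linearForm H g})

/-- The local De Concini–Procesi algebra `D_y(M, H)`. -/
abbrev DPAlgebra (H : Set M) (L : BlowupStage M) (y : L.carrier) : Type u :=
  MvPolynomial H ℚ ⧸ dpIdeal H L y

theorem dpIdeal_mono (H : Set M) (L : BlowupStage M) {y z : L.carrier} (h : y ≤ z) :
    dpIdeal H L y ≤ dpIdeal H L z := by
  refine Ideal.span_mono (Set.union_subset_union_left _ ?_)
  rintro _ ⟨T, hT, rfl⟩
  refine ⟨T, fun hn => hT (hn.mono (Set.union_subset_union_left _ ?_)), rfl⟩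
  rintro g ⟨hg, a, ha, hy⟩
  exact ⟨hg, a, ha, hy.trans h⟩

/-- The canonical surjection `D_y(M, H) → D_z(M, H)` for `y ≤ z`. -/
def dpRestrict (H : Set M) (L : BlowupStage M) {y z : L.carrier} (h : y ≤ z) :
    DPAlgebra H L y →ₐ[ℚ] DPAlgebra H L z :=
  Ideal.Quotient.factorₐ ℚ (dpIdeal_mono H L h)

theorem dpRestrict_mk (H : Set M) (L : BlowupStage M) {y z : L.carrier} (h : y ≤ z)
    (f : MvPolynomial H ℚ) :
    dpRestrict H L h (Ideal.Quotient.mkₐ ℚ (dpIdeal H L y) f) =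
      Ideal.Quotient.mkₐ ℚ (dpIdeal H L z) f :=
  rfl

theorem dpRestrict_id (H : Set M) (L : BlowupStage M) (y : L.carrier) :
    (dpRestrict H L (le_refl y)).toLinearMap = LinearMap.id := by
  refine LinearMap.ext fun m => ?_
  obtain ⟨f, rfl⟩ := Ideal.Quotient.mkₐ_surjective ℚ (dpIdeal H L y) m
  exact dpRestrict_mk H L (le_refl y) f

theorem dpRestrict_comp (H : Set M) (L : BlowupStage M) {x y z : L.carrier} (h : x ≤ y)
    (h' : y ≤ z) :
    (dpRestrict H L (h.trans h')).toLinearMap =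
      (dpRestrict H L h').toLinearMap ∘ₗ (dpRestrict H L h).toLinearMap := by
  refine LinearMap.ext fun m => ?_
  obtain ⟨f, rfl⟩ := Ideal.Quotient.mkₐ_surjective ℚ (dpIdeal H L x) m
  rw [LinearMap.comp_apply, AlgHom.toLinearMap_apply, AlgHom.toLinearMap_apply,
    AlgHom.toLinearMap_apply, dpRestrict_mk, dpRestrict_mk, dpRestrict_mk]

/-- The homogeneous part `D^i_y(M, H)` of degree `i`, where all variables have degree two. -/
def dpPart (H : Set M) (L : BlowupStage M) (y : L.carrier) (i : ℕ) :
    Submodule ℚ (DPAlgebra H L y) :=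
  (MvPolynomial.weightedHomogeneousSubmodule ℚ (fun _ : H => 2) i).map
    (Ideal.Quotient.mkₐ ℚ (dpIdeal H L y)).toLinearMap

theorem dpRestrict_mem_dpPart (H : Set M) (L : BlowupStage M) {y z : L.carrier} (h : y ≤ z)
    (i : ℕ) : ∀ m ∈ dpPart H L y i, (dpRestrict H L h).toLinearMap m ∈ dpPart H L z i := by
  rintro _ ⟨f, hf, rfl⟩
  exact ⟨f, hf, rfl⟩

/-- The sheaf `D(M, H)` on the opposite of the blowup, with `D(y) = D_y(M, H)`. -/
def dpSheaf (H : Set M) (L : BlowupStage M) : PosetSheaf L.carrierᵒᵈ where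
  obj Y := ModuleCat.of ℚ (DPAlgebra H L (OrderDual.ofDual Y.unop))
  map f := ModuleCat.ofHom
    (dpRestrict H L (OrderDual.ofDual_le_ofDual.2 f.unop.le)).toLinearMap
  map_id _ := congrArg ModuleCat.ofHom (dpRestrict_id H L _)
  map_comp f g := congrArg ModuleCat.ofHom
    (dpRestrict_comp H L (OrderDual.ofDual_le_ofDual.2 f.unop.le)
      (OrderDual.ofDual_le_ofDual.2 g.unop.le))

/-- The homogeneous part `D^i(M, H)` of degree `i` of the sheaf `D(M, H)`. -/
def dpSheafPart (H : Set M) (L : BlowupStage M) (i : ℕ) : PosetSheaf L.carrierᵒᵈ where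
  obj Y := ModuleCat.of ℚ (dpPart H L (OrderDual.ofDual Y.unop) i)
  map f := ModuleCat.ofHom
    ((dpRestrict H L (OrderDual.ofDual_le_ofDual.2 f.unop.le)).toLinearMap.restrict
      (dpRestrict_mem_dpPart H L (OrderDual.ofDual_le_ofDual.2 f.unop.le) i))
  map_id _ := congrArg ModuleCat.ofHom (LinearMap.ext fun m => Subtype.ext
    (LinearMap.congr_fun (dpRestrict_id H L _) m.1))
  map_comp f g := congrArg ModuleCat.ofHom (LinearMap.ext fun m => Subtype.ext
    (LinearMap.congr_fun (dpRestrict_comp H L (OrderDual.ofDual_le_ofDual.2 f.unop.le)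
      (OrderDual.ofDual_le_ofDual.2 g.unop.le)) m.1))

end DeConciniProcesi

end

/-! Write P for the iterated blowup. Exactness can be checked on stalks. At (x, y) the augmented
complex is the flag complex of P_{≤ x}, augmented by ℚ if x = ⊥ and by 0 otherwise, tensored with a
vector space. For x = ⊥ only an isomorphism in degree zero remains. For x ≠ ⊥ the flag complex is
contractible (`flagHomotopy_comp_flagDiff_zero`, `flagDiff_comp_flagHomotopy_add`), as soon as there
is an a ≤ x whose join within P_{≤ x} with any z not above a has rank one more than z. The homotopy
is the transpose of the signed sum over k of the insertions z ↦ (z_0 < ⋯ < z_k < a ∨ z_k < ⋯ < a ∨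
z_j).

In M any atom a ≤ x will do, by semimodularity. The existence of such elements passes to blowups
(`IsLocallySemimodular.blowup`): below an old element nothing changes, and below (p, x) the new atom
(p, ⊥) works, since its join with an old z is (p, z). The rank of (p, x) is rank x + 1 ≤ rank (p ∨
x), so ranks stay bounded by r and there are no flags of length j > r.

Acyclicity holds over every finite poset. Whether a flag lies in P_{≤ x} depends only on its top
element, so pr₁^* F^j ⊗ pr₂^* G is the direct sum, over all z of rank j, of the direct images u_* of
Fl^j(P_{≤ z}) ⊗ G along u : y ↦ (z, y), from the opposite of P_{≥ z} to the intervals. Here u_* is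
exact and preserves injectives, and Γ ∘ u_* is evaluation at z, the greatest element of the opposite
of P_{≥ z}. Hence each summand has no higher cohomology (`isZero_sheafCohomology_upperPushforward`).
-/

noncomputable section

/-! ## Exactness and acyclicity in functor categories -/

/-- Evaluation commutes with homology, and a functor is zero if all its values are. -/
theorem exact_of_exact_evaluation {J : Type*} [Category J] {C : Type*} [Category C] [Abelian C]
    (S : ShortComplex (J ⥤ C)) (h : ∀ t, (S.map ((evaluation J C).obj t)).Exact) : S.Exact := by
  rw [ShortComplex.exact_iff_isZero_homology, Functor.isZero_iff]
  intro t
  exact ((ShortComplex.exact_iff_isZero_homology _).1 (h t)).of_iso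
    (S.mapHomologyIso ((evaluation J C).obj t)).symm

/-- The image of an injective resolution under an exact right adjoint whose left adjoint preserves
monomorphisms. -/
def InjectiveResolution.mapOfAdjunction {A B : Type*} [Category A] [Abelian A] [Category B]
    [Abelian B] {L : B ⥤ A} {R : A ⥤ B} (adj : L ⊣ R) [L.PreservesMonomorphisms]
    [R.Additive] [R.PreservesHomology] {X : A} (I : InjectiveResolution X) :
    InjectiveResolution (R.obj X) where
  cocomplex := (R.mapHomologicalComplex _).obj I.cocomplex
  injective _ := Injective.injective_of_adjoint adj _
  ι := (HomologicalComplex.singleMapHomologicalComplex R _ 0).inv.app X ≫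
    (R.mapHomologicalComplex _).map I.ι
  quasiIso := inferInstance

/-- The functor R carries an injective resolution I of X to one of R X. Applying Γ gives the image
of I under the exact functor R ⋙ Γ, which has no homology in positive degrees. -/
theorem isZero_rightDerived_obj_of_adjunction {A B D : Type*} [Category A] [Abelian A]
    [HasInjectiveResolutions A] [Category B] [Abelian B] [HasInjectiveResolutions B] [Category D]
    [Abelian D] {L : B ⥤ A} {R : A ⥤ B} (adj : L ⊣ R) [L.PreservesMonomorphisms]
    [R.Additive] [R.PreservesHomology] (Γ : B ⥤ D) [Γ.Additive] [(R ⋙ Γ).PreservesHomology]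
    (X : A) {q : ℕ} (hq : 0 < q) : IsZero ((Γ.rightDerived q).obj (R.obj X)) := by
  obtain ⟨n, rfl⟩ : ∃ n, q = n + 1 := ⟨q - 1, by omega⟩
  let I := injectiveResolution X
  refine IsZero.of_iso ?_ ((InjectiveResolution.mapOfAdjunction adj I).isoRightDerivedObj Γ (n + 1))
  refine (HomologicalComplex.exactAt_iff_isZero_homology _ _).1 ?_
  have h := (I.cocomplex_exactAt_succ n)
  rw [HomologicalComplex.exactAt_iff] at h ⊢
  exact h.map (R ⋙ Γ)

/-- The sum of lifts of f and g to the resolutions is a lift of f + g. Additivity is what lets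
cohomology respect direct sum decompositions. -/
theorem rightDerived_additive {C D : Type*} [Category C] [Abelian C] [HasInjectiveResolutions C]
    [Category D] [Abelian D] (F : C ⥤ D) [F.Additive] (n : ℕ) : (F.rightDerived n).Additive where
  map_add {X Y f g} := by
    have w (h : X ⟶ Y) := InjectiveResolution.desc_commutes h (injectiveResolution Y)
      (injectiveResolution X)
    rw [F.rightDerived_map_eq n f _ (w f), F.rightDerived_map_eq n g _ (w g),
      F.rightDerived_map_eq n (f + g) (InjectiveResolution.desc f _ _ +
        InjectiveResolution.desc g _ _) (by
          rw [Preadditive.comp_add, w f, w g, ← Preadditive.add_comp]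
          congr 1
          ext
          simp),
      Functor.map_add, Preadditive.add_comp, Preadditive.comp_add]

/-- An object that is a retract of a finite sum of objects killed by an additive functor is killed
by the functor. -/
theorem isZero_map_of_sum_comp_eq_id {C D : Type*} [Category C] [Preadditive C] [Category D]
    [Preadditive D] (F : C ⥤ D) [F.Additive] {ι : Type*} (s : Finset ι) {X : C}
    {K : ι → C} (p : ∀ z, X ⟶ K z) (i : ∀ z, K z ⟶ X) (h : ∑ z ∈ s, p z ≫ i z = 𝟙 X)
    (hK : ∀ z ∈ s, IsZero (F.obj (K z))) : IsZero (F.obj X) := by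
  rw [IsZero.iff_id_eq_zero, ← F.map_id, ← h, F.map_sum]
  refine Finset.sum_eq_zero fun z hz => ?_
  rw [F.map_comp, (hK z hz).eq_of_tgt (F.map (p z)) 0, zero_comp]

/-! ## Sheaves on the poset of intervals pushed forward from upper sets -/

section Pushforward

variable {P : Type u} [PartialOrder P] (z : P)

theorem PosetSheaf.map_map_apply (A : PosetSheaf P) {X Y Z : Pᵒᵖ} (f : X ⟶ Y) (g : Y ⟶ Z)
    (h : X ⟶ Z) (m : A.obj X) : (A.map g).hom ((A.map f).hom m) = (A.map h).hom m := by
  rw [Subsingleton.elim h (f ≫ g), A.map_comp]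
  rfl

/-- The map `y ↦ (z, y)` from the opposite of `P_{≥ z}` to the poset of intervals. -/
def IntervalPoset.upper : (Set.Ici z)ᵒᵈ →o IntervalPoset P :=
  ⟨fun y => ⟨(z, OrderDual.toDual (OrderDual.ofDual y).1), (OrderDual.ofDual y).2⟩,
    fun _ _ h => ⟨le_rfl, h⟩⟩

/-- The element `y` of the opposite of `P_{≥ z}` for an interval `(x, y)` with `z ≤ x`. -/
def IntervalPoset.right {z : P} (Z : IntervalPoset P) (h : z ≤ IntervalPoset.pr₁ P Z) :
    (Set.Ici z)ᵒᵈ :=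
  OrderDual.toDual ⟨OrderDual.ofDual Z.1.2, h.trans Z.2⟩

variable {z} in
theorem IntervalPoset.right_mono {Z W : IntervalPoset P} (hZW : Z ≤ W)
    (h : z ≤ IntervalPoset.pr₁ P Z) :
    Z.right h ≤ W.right (h.trans ((IntervalPoset.pr₁ P).monotone hZW)) :=
  hZW.2

variable {z} in
theorem IntervalPoset.upper_right_le (Z : IntervalPoset P) (h : z ≤ IntervalPoset.pr₁ P Z) :
    IntervalPoset.upper z (Z.right h) ≤ Z :=
  ⟨h, le_rfl⟩

/-- The direct image of a sheaf under `y ↦ (z, y)`. -/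
def upperPushforwardObj (A : PosetSheaf (Set.Ici z)ᵒᵈ) : PosetSheaf (IntervalPoset P) where
  -- The preimage of the principal ideal of (x, y) is the principal ideal of y if z ≤ x, and empty
  -- otherwise. So the sections are A(y) or zero.
  obj Z := ModuleCat.of ℚ
    ((h : PLift (z ≤ IntervalPoset.pr₁ P Z.unop)) → A.obj (op (Z.unop.right h.down)))
  map {Z W} f := ModuleCat.ofHom <| LinearMap.pi fun h =>
    (A.map (homOfLE (IntervalPoset.right_mono f.unop.le h.down)).op).hom ∘ₗ
      LinearMap.proj ⟨h.down.trans ((IntervalPoset.pr₁ P).monotone f.unop.le)⟩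
  map_id Z := by
    ext1
    refine LinearMap.ext fun m => funext fun h => ?_
    change (A.map (𝟙 _)).hom (m h) = m h
    simp
  map_comp f g := by
    ext1
    refine LinearMap.ext fun m => funext fun h => ?_
    exact (A.map_map_apply _ _ _ _).symm

/-- The direct image functor under `y ↦ (z, y)`. -/
def upperPushforward : PosetSheaf (Set.Ici z)ᵒᵈ ⥤ PosetSheaf (IntervalPoset P) where
  obj := upperPushforwardObj z
  map {A B} φ :=
    { app Z := ModuleCat.ofHom <| LinearMap.pi fun h => (φ.app _).hom ∘ₗ LinearMap.proj h
      naturality Z W f := by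
        ext1
        refine LinearMap.ext fun m => funext fun h => ?_
        exact LinearMap.congr_fun (congrArg ModuleCat.Hom.hom (φ.naturality _)) _ }
  map_id A := by
    ext Z : 2
    rfl
  map_comp φ ψ := by
    ext Z : 2
    rfl

/-- The inverse image functor under `y ↦ (z, y)`. -/
abbrev upperPullback : PosetSheaf (IntervalPoset P) ⥤ PosetSheaf (Set.Ici z)ᵒᵈ :=
  (Functor.whiskeringLeft _ _ _).obj (IntervalPoset.upper z).monotone.functor.op

/-- The inverse image is left adjoint to the direct image. -/
def upperAdjunction : upperPullback z ⊣ upperPushforward z :=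
  Adjunction.mkOfHomEquiv
    { homEquiv F A :=
        { toFun φ :=
            -- The direct image restricts from (x, y) to (z, y) by the identity of A(y), so a map
            -- into it is determined by its values at the intervals (z, y).
            { app Z := ModuleCat.ofHom <| LinearMap.pi fun h =>
                (φ.app (op (Z.unop.right h.down))).hom ∘ₗ
                  (F.map (homOfLE (Z.unop.upper_right_le h.down)).op).hom
              naturality Z W f := by
                ext1
                refine LinearMap.ext fun m => funext fun h => ?_
                change (φ.app _).hom ((F.map _).hom ((F.map f).hom m)) =
                  (A.map _).hom ((φ.app _).hom ((F.map _).hom m))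
                have := LinearMap.congr_fun (congrArg ModuleCat.Hom.hom (φ.naturality
                  (homOfLE (IntervalPoset.right_mono f.unop.le h.down)).op))
                  ((F.map (homOfLE (Z.unop.upper_right_le
                    (h.down.trans ((IntervalPoset.pr₁ P).monotone f.unop.le)))).op).hom m)
                refine Eq.trans ?_ this
                exact congrArg (φ.app _).hom ((F.map_map_apply f _
                  (homOfLE ((W.unop.upper_right_le h.down).trans f.unop.le)).op m).trans
                  (F.map_map_apply _ _ _ m).symm) }
          invFun ψ :=
            { app Y := ModuleCat.ofHom <|
                LinearMap.proj (⟨le_rfl⟩ : PLift (z ≤ z)) ∘ₗ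
                  (ψ.app (op (IntervalPoset.upper z Y.unop))).hom
              naturality Y Y' f := by
                ext1
                refine LinearMap.ext fun m => ?_
                exact congrFun (LinearMap.congr_fun (congrArg ModuleCat.Hom.hom (ψ.naturality
                  ((IntervalPoset.upper z).monotone.functor.op.map f))) m) ⟨le_rfl⟩ }
          left_inv φ := by
            ext Y : 2
            ext1
            refine LinearMap.ext fun m => ?_
            change (φ.app Y).hom ((F.map (𝟙 _)).hom m) = (φ.app Y).hom m
            rw [F.map_id]
            rfl
          right_inv ψ := by
            ext Z : 2
            ext1
            refine LinearMap.ext fun m => funext fun h => ?_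
            have := congrFun (LinearMap.congr_fun (congrArg ModuleCat.Hom.hom (ψ.naturality
                  (homOfLE (Z.unop.upper_right_le h.down)).op)) m) ⟨le_rfl⟩
            refine this.trans ?_
            change (A.map (𝟙 _)).hom _ = _
            rw [A.map_id]
            rfl }
      homEquiv_naturality_left_symm f g := by
        ext Y : 2
        rfl
      homEquiv_naturality_right f g := by
        ext Z : 2
        rfl }

/-! ### Exactness of the direct image and of its global sections. -/

instance : (upperPushforward z).Additive where
  map_add := by
    intros
    ext Z : 2
    rfl

/-- Each stalk of the direct image is a stalk of the given sheaf or zero, so surjectivity is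
inherited stalkwise. -/
instance : (upperPushforward z).PreservesEpimorphisms where
  preserves {A B} φ _ := by
    have : ∀ Z, Epi (((upperPushforward z).map φ).app Z) := fun Z => by
      rw [ModuleCat.epi_iff_surjective]
      intro m
      have h : ∀ Y, Function.Surjective (φ.app Y).hom := fun Y =>
        (ModuleCat.epi_iff_surjective _).1 inferInstance
      choose n hn using fun h' : PLift (z ≤ IntervalPoset.pr₁ P Z.unop) => h _ (m h')
      exact ⟨n, funext hn⟩
    exact NatTrans.epi_of_epi_app _

/-- A right adjoint is left exact. If it also preserves epimorphisms, it preserves short exact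
sequences, hence homology. -/
theorem preservesHomology_of_adjunction {A B : Type*} [Category A] [Abelian A] [Category B]
    [Abelian B] {L : B ⥤ A} {R : A ⥤ B} (adj : L ⊣ R) [R.Additive] [R.PreservesEpimorphisms] :
    R.PreservesHomology := by
  have := adj.rightAdjoint_preservesLimits
  refine (R.exact_tfae.out 0 2).1 fun S hS => ?_
  have := hS.mono_f
  have := hS.epi_g
  have hl : PreservesFiniteLimits R := inferInstance
  have h := (R.preservesFiniteLimits_iff_forall_exact_map_and_mono).1 hl S hS
  have : Mono (S.map R).f := h.2
  have : Epi (S.map R).g := inferInstanceAs (Epi (R.map S.g))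
  exact ⟨h.1⟩

/-- The sections of a direct image from `P_{≥ z}` that extend a given value at `(z, z)`. -/
def upperSection (A : PosetSheaf (Set.Ici z)ᵒᵈ) :
    A.obj (op (OrderDual.toDual ⟨z, le_rfl⟩)) ⟶
      (globalSections (IntervalPoset P)).obj ((upperPushforward z).obj A) :=
  limit.lift _
    { pt := _
      π :=
        { app Z := ModuleCat.ofHom <| LinearMap.pi fun h =>
            (A.map (homOfLE (show Z.unop.right h.down ≤ _ from (Z.unop.right h.down).2)).op).hom
          naturality Z W f := by
            ext1
            refine LinearMap.ext fun m => funext fun h => ?_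
            exact (A.map_map_apply _ _ _ m).symm } }

theorem upperSection_naturality {A B : PosetSheaf (Set.Ici z)ᵒᵈ} (φ : A ⟶ B) :
    upperSection z A ≫ (upperPushforward z ⋙ globalSections (IntervalPoset P)).map φ =
      φ.app _ ≫ upperSection z B := by
  refine limit.hom_ext fun Z => ?_
  simp only [upperSection, Functor.comp_map, Category.assoc, limMap_π, limit.lift_π,
    limit.lift_π_assoc, lim_map]
  ext1
  refine LinearMap.ext fun m => funext fun h => ?_
  exact (LinearMap.congr_fun (congrArg ModuleCat.Hom.hom (φ.naturality _)) m)

/-- A global section is determined by its value at (z, z): the value at (x, y) agrees with the one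
at (z, y), which is restricted from (z, z). So evaluation at (z, z) followed by `upperSection` is
the identity. -/
instance (A : PosetSheaf (Set.Ici z)ᵒᵈ) : Epi (upperSection z A) := by
  let T := (upperPushforward z).obj A
  let Zz : (IntervalPoset P)ᵒᵖ := op ⟨(z, OrderDual.toDual z), le_rfl⟩
  let e : T.obj Zz ⟶ A.obj (op (OrderDual.toDual ⟨z, le_rfl⟩)) :=
    ModuleCat.ofHom (LinearMap.proj (⟨le_rfl⟩ : PLift (z ≤ z)))
  suffices h : limit.π T Zz ≫ e ≫ upperSection z A = 𝟙 _ from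
    epi_of_epi_fac ((Category.assoc _ _ _).trans h)
  refine limit.hom_ext fun Z => ?_
  simp only [upperSection, Category.assoc, limit.lift_π, Category.id_comp]
  ext1
  refine LinearMap.ext fun m => funext fun h => ?_
  let W : (IntervalPoset P)ᵒᵖ := op (IntervalPoset.upper z (Z.unop.right h.down))
  have hZ := LinearMap.congr_fun (congrArg ModuleCat.Hom.hom
    (limit.w T (homOfLE (Z.unop.upper_right_le h.down)).op)) m
  have hz := LinearMap.congr_fun (congrArg ModuleCat.Hom.hom
    (limit.w T (show Zz ⟶ W from (homOfLE (show W.unop ≤ Zz.unop from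
      ⟨le_rfl, (Z.unop.right h.down).2⟩)).op))) m
  refine (congrFun (hz.trans hZ.symm) ⟨le_rfl⟩).trans ?_
  exact LinearMap.congr_fun (congrArg ModuleCat.Hom.hom (A.map_id _)) _

/-- By naturality of `upperSection`, surjectivity on global sections follows from surjectivity on
the stalks at z. -/
instance : (upperPushforward z ⋙ globalSections (IntervalPoset P)).PreservesEpimorphisms where
  preserves {A B} φ _ := by
    have : Epi (φ.app (op (OrderDual.toDual ⟨z, le_rfl⟩))) := inferInstance
    have := epi_comp (φ.app (op (OrderDual.toDual ⟨z, le_rfl⟩))) (upperSection z B)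
    rw [← upperSection_naturality] at this
    exact epi_of_epi (upperSection z A) _

theorem isZero_sheafCohomology_upperPushforward (A : PosetSheaf (Set.Ici z)ᵒᵈ) {q : ℕ}
    (hq : 0 < q) : IsZero (sheafCohomology q ((upperPushforward z).obj A)) := by
  have := preservesHomology_of_adjunction (upperAdjunction z)
  -- The composite of direct image and global sections is right adjoint to the constant sheaf
  -- followed by the inverse image, so the same criterion applies to it.
  have := preservesHomology_of_adjunction ((constLimAdj).comp (upperAdjunction z))
  exact isZero_rightDerived_obj_of_adjunction (upperAdjunction z)
    (globalSections (IntervalPoset P)) A hq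

end Pushforward

/-! ## Sums of flags -/

section FlagSums

variable {P : Type u} [PartialOrder P] [Finite P] {x : P} {j : ℕ}

theorem flagSum_congr {p q : (Fin (j + 1) → P) → Prop}
    (h : ∀ Y : RankedFlag x j, p Y.elt ↔ q Y.elt) : flagSum x j p = flagSum x j q := by
  classical
  unfold flagSum
  exact Finset.sum_congr (Finset.filter_congr fun Y _ => h Y) fun _ _ => rfl

theorem flagSum_eq_zero {p : (Fin (j + 1) → P) → Prop} (h : ∀ Y : RankedFlag x j, ¬ p Y.elt) :
    flagSum x j p = 0 := by
  classical
  unfold flagSum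
  rw [Finset.filter_false_of_mem fun Y _ => h Y, Finset.sum_empty]

theorem flagSum_eq_add (p q : (Fin (j + 1) → P) → Prop) :
    flagSum x j p = flagSum x j (fun z => p z ∧ q z) + flagSum x j (fun z => p z ∧ ¬ q z) := by
  classical
  unfold flagSum
  rw [← Finset.sum_filter_add_sum_filter_not _ (fun Y => q Y.elt)]
  simp only [Finset.filter_filter]

theorem flagSum_eq_single (Y : RankedFlag x j) :
    (flagSum x j fun z => z = Y.elt) = Finsupp.single Y 1 := by
  classical
  unfold flagSum
  rw [Finset.sum_eq_single_of_mem Y (by simp)]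
  intro Z hZ hne
  exact absurd (RankedFlag.ext (by simpa using hZ)) hne

omit [Finite P] in
theorem RankedFlag.le_top (Y : RankedFlag x j) (i : Fin (j + 1)) : Y.elt i ≤ x :=
  (Y.strictMono.monotone (Fin.le_last i)).trans Y.le

omit [Finite P] in
theorem eq_of_le_of_height_eq_natCast {y z : P} (h : y ≤ z) {n : ℕ} (hy : Order.height y = n)
    (hz : Order.height z = n) : y = z := by
  by_contra hne
  have := Order.height_strictMono (lt_of_le_of_ne h hne) (hy ▸ ENat.natCast_lt_top n)
  rw [hy, hz] at this
  exact lt_irrefl _ this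

end FlagSums

/-! ## Inclusions of flag spaces -/

section FlagInclude

variable {P : Type u} [PartialOrder P] [Finite P]

/-- The inclusion of the flags in `P_{≤ z}` into the flags in `P_{≤ x}`, for `z ≤ x`. -/
def flagIncludeAux {z x : P} (h : z ≤ x) (j : ℕ) :
    (RankedFlag z j →₀ ℚ) →ₗ[ℚ] (RankedFlag x j →₀ ℚ) :=
  Finsupp.linearCombination ℚ fun Y =>
    Finsupp.single (⟨Y.elt, Y.strictMono, Y.rank_eq, Y.le.trans h⟩ : RankedFlag x j) 1

theorem flagIncludeAux_flagSum {z x : P} (h : z ≤ x) (j : ℕ) (p : (Fin (j + 1) → P) → Prop) :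
    flagIncludeAux h j (flagSum z j p) =
      flagSum x j fun y => p y ∧ y (Fin.last j) ≤ z := by
  classical
  unfold flagSum flagIncludeAux
  simp only [map_sum, Finsupp.linearCombination_single, one_smul]
  refine Finset.sum_bij'
    (fun Y _ => (⟨Y.elt, Y.strictMono, Y.rank_eq, Y.le.trans h⟩ : RankedFlag x j))
    (fun Y hY => (⟨Y.elt, Y.strictMono, Y.rank_eq, (Finset.mem_filter.1 hY).2.2⟩ :
      RankedFlag z j)) ?_ ?_ ?_ ?_ ?_
  · intro Y hY
    simpa using ⟨(Finset.mem_filter.1 hY).2, Y.le⟩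
  · intro Y hY
    simpa using (Finset.mem_filter.1 hY).2.1
  all_goals exact fun _ _ => rfl

/-- The map `Fl^j(P_{≤ z}) → Fl^j(P_{≤ x})` induced by the inclusion of flags, for `z ≤ x`. -/
def flagInclude {z x : P} (h : z ≤ x) (j : ℕ) : FlagSpace z j →ₗ[ℚ] FlagSpace x j :=
  Submodule.mapQ _ _ (flagIncludeAux h j) <| by
    refine Submodule.span_le.2 ?_
    rintro _ ⟨Y, k, h0, hk, rfl⟩
    change flagIncludeAux h j _ ∈ flagRelations x j
    rw [flagIncludeAux_flagSum]
    exact flagSum_mem _ k h0 hk fun w w' hw hp => ⟨fun l hl => (hw l hl).symm.trans (hp.1 l hl),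
      (hw _ hk.ne').symm.le.trans hp.2⟩

/-- Generators are written as `flagSum` with the predicate z = Y, because every map between flag
spaces is computed through its effect on predicates. -/
theorem flagSpace_hom_ext {x : P} {j : ℕ} {V : Type*} [AddCommGroup V] [Module ℚ V]
    {f g : FlagSpace x j →ₗ[ℚ] V}
    (h : ∀ Y : RankedFlag x j, f (Submodule.Quotient.mk (flagSum x j fun z => z = Y.elt)) =
      g (Submodule.Quotient.mk (flagSum x j fun z => z = Y.elt))) : f = g := by
  refine Submodule.linearMap_qext _ (Finsupp.lhom_ext' fun Y => LinearMap.ext_ring ?_)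
  have := h Y
  rw [flagSum_eq_single] at this
  exact this

theorem flagRestrict_mk_flagSum {x₁ x₀ : P} (h : x₀ ≤ x₁) (j : ℕ) (p : (Fin (j + 1) → P) → Prop) :
    flagRestrict h j (Submodule.Quotient.mk (flagSum x₁ j p)) =
      Submodule.Quotient.mk (flagSum x₀ j p) :=
  congrArg Submodule.Quotient.mk (flagRestrictAux_flagSum h j p)

theorem flagInclude_mk_flagSum {z x : P} (h : z ≤ x) (j : ℕ) (p : (Fin (j + 1) → P) → Prop) :
    flagInclude h j (Submodule.Quotient.mk (flagSum z j p)) =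
      Submodule.Quotient.mk (flagSum x j fun y => p y ∧ y (Fin.last j) ≤ z) :=
  congrArg Submodule.Quotient.mk (flagIncludeAux_flagSum h j p)

theorem flagRestrict_comp_flagInclude {z x₀ x₁ : P} (h₀ : z ≤ x₀) (h : x₀ ≤ x₁) (j : ℕ) :
    flagRestrict h j ∘ₗ flagInclude (h₀.trans h) j = flagInclude h₀ j :=
  flagSpace_hom_ext fun Y => by
    rw [LinearMap.comp_apply, flagInclude_mk_flagSum, flagRestrict_mk_flagSum,
      flagInclude_mk_flagSum]

/-- As z has rank j, a flag of length j below z must end at z, so it does not lie below x₀. -/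
theorem flagRestrict_comp_flagInclude_eq_zero {z x₀ x₁ : P} {j : ℕ} (hz : Order.height z = j)
    (h₀ : ¬ z ≤ x₀) (h : x₀ ≤ x₁) (h₁ : z ≤ x₁) :
    flagRestrict h j ∘ₗ flagInclude h₁ j = 0 :=
  flagSpace_hom_ext fun Y => by
    rw [LinearMap.comp_apply, flagInclude_mk_flagSum, flagRestrict_mk_flagSum,
      flagSum_eq_zero]
    · rfl
    · rintro Z ⟨-, hZ⟩
      have := eq_of_le_of_height_eq_natCast hZ (by simpa using Z.rank_eq (Fin.last j)) hz
      exact h₀ (this ▸ Z.le)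

open Classical in
/-- The flag space is the sum of its parts indexed by the top elements of the flags. -/
theorem sum_flagInclude_comp_flagRestrict (x : P) (j : ℕ) (s : Finset P)
    (hs : ∀ z, z ∈ s ↔ Order.height z = j) :
    ∑ z ∈ s, (if h : z ≤ x then flagInclude h j ∘ₗ flagRestrict h j else 0) = LinearMap.id := by
  refine flagSpace_hom_ext fun Y => ?_
  have hY : Order.height (Y.elt (Fin.last j)) = j := by simpa using Y.rank_eq (Fin.last j)
  -- Among the elements of rank j, only the top element of Y lies above all of Y.
  rw [LinearMap.sum_apply, Finset.sum_eq_single_of_mem (Y.elt (Fin.last j)) ((hs _).2 hY)]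
  · rw [dif_pos Y.le, LinearMap.comp_apply, flagRestrict_mk_flagSum, flagInclude_mk_flagSum,
      LinearMap.id_apply]
    exact congrArg _ (flagSum_congr fun Z => ⟨fun h => h.1, fun h => ⟨h, by rw [h]⟩⟩)
  · intro z hz hne
    split_ifs with h
    · rw [LinearMap.comp_apply, flagRestrict_mk_flagSum, flagInclude_mk_flagSum, flagSum_eq_zero]
      · rfl
      · rintro Z ⟨hZ, hle⟩
        rw [hZ] at hle
        exact hne (eq_of_le_of_height_eq_natCast hle hY ((hs z).1 hz)).symm
    · rfl

end FlagInclude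

/-! ## Acyclicity of the flag sheaves tensored with a sheaf on the opposite poset -/

section Acyclic

variable {P : Type u} [PartialOrder P]

/-- The inclusion of the opposite of `P_{≥ z}` into the opposite of `P`. -/
def upperInclusion (z : P) : (Set.Ici z)ᵒᵈ →o Pᵒᵈ :=
  ⟨fun y => OrderDual.toDual (OrderDual.ofDual y).1, fun _ _ h => h⟩

/-- The tensor product of a vector space with the restriction of `G` to the opposite of
`P_{≥ z}`. -/
def tensorUpper (V : Type u) [AddCommGroup V] [Module ℚ V] (G : PosetSheaf Pᵒᵈ) (z : P) :
    PosetSheaf (Set.Ici z)ᵒᵈ where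
  obj Y := ModuleCat.of ℚ (V ⊗[ℚ] (sheafPullback (upperInclusion z) G).obj Y)
  map f := ModuleCat.ofHom
    (TensorProduct.map LinearMap.id ((sheafPullback (upperInclusion z) G).map f).hom)
  map_id Y := by
    ext1
    change TensorProduct.map _ ((sheafPullback (upperInclusion z) G).map (𝟙 Y)).hom = _
    rw [CategoryTheory.Functor.map_id]
    exact TensorProduct.map_id
  map_comp f g := by
    ext1
    change TensorProduct.map _ ((sheafPullback (upperInclusion z) G).map (f ≫ g)).hom =
      TensorProduct.map _ _ ∘ₗ TensorProduct.map _ _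
    rw [← TensorProduct.map_comp, Functor.map_comp]
    rfl

variable [Finite P] (G : PosetSheaf Pᵒᵈ) (j : ℕ) (z : P)

/-- The sheaf `pr₁^* F^j ⊗ pr₂^* G` on the poset of intervals. -/
abbrev flagTensorSheaf : PosetSheaf (IntervalPoset P) :=
  tensorSheaf (sheafPullback (IntervalPoset.pr₁ P) (flagSheaf P j))
    (sheafPullback (IntervalPoset.pr₂ P) G)

/-- The part of `pr₁^* F^j ⊗ pr₂^* G` given by the flags with top element `z`. -/
abbrev flagTensorPart : PosetSheaf (IntervalPoset P) :=
  (upperPushforward z).obj (tensorUpper (FlagSpace z j) G z)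

/-- The projection to the part given by the flags with top element `z`. -/
def flagTensorProj : flagTensorSheaf G j ⟶ flagTensorPart G j z where
  app Z := ModuleCat.ofHom <| LinearMap.pi fun h =>
    TensorProduct.map (flagRestrict h.down j) LinearMap.id
  naturality Z W f := by
    ext1
    refine LinearMap.ext fun m => funext fun h => ?_
    have hz : z ≤ IntervalPoset.pr₁ P Z.unop :=
      h.down.trans ((IntervalPoset.pr₁ P).monotone f.unop.le)
    change (TensorProduct.map (flagRestrict h.down j) LinearMap.id ∘ₗ
        TensorProduct.map (flagRestrict ((IntervalPoset.pr₁ P).monotone f.unop.le) j)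
          (G.map _).hom) m =
      (TensorProduct.map LinearMap.id (G.map _).hom ∘ₗ
        TensorProduct.map (flagRestrict hz j) LinearMap.id) m
    rw [← TensorProduct.map_comp, ← TensorProduct.map_comp, flagRestrict_comp]
    rfl

open Classical in
/-- The inclusion of the part given by the flags with top element `z`. -/
def flagTensorIncl (hz : Order.height z = j) : flagTensorPart G j z ⟶ flagTensorSheaf G j where
  app Z := ModuleCat.ofHom <| if h : z ≤ IntervalPoset.pr₁ P Z.unop then
    TensorProduct.map (flagInclude h j) LinearMap.id ∘ₗ LinearMap.proj ⟨h⟩ else 0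
  naturality Z W f := by
    ext1
    have hWZ := (IntervalPoset.pr₁ P).monotone f.unop.le
    by_cases hZ : z ≤ IntervalPoset.pr₁ P Z.unop
    · have key : (TensorProduct.map (flagRestrict hWZ j)
          ((sheafPullback (IntervalPoset.pr₂ P) G).map f).hom ∘ₗ
            TensorProduct.map (flagInclude hZ j) LinearMap.id) =
          TensorProduct.map (flagRestrict hWZ j ∘ₗ flagInclude hZ j)
            ((sheafPullback (IntervalPoset.pr₂ P) G).map f).hom := by
        rw [← TensorProduct.map_comp]
        rfl
      by_cases hW : z ≤ IntervalPoset.pr₁ P W.unop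
      · rw [flagRestrict_comp_flagInclude hW hWZ] at key
        simp only [dif_pos hZ, dif_pos hW]
        refine LinearMap.ext fun m => ?_
        refine Eq.trans ?_ (LinearMap.congr_fun key (m ⟨hZ⟩)).symm
        change (TensorProduct.map (flagInclude hW j) LinearMap.id ∘ₗ
          TensorProduct.map LinearMap.id (G.map _).hom) _ = _
        rw [← TensorProduct.map_comp]
        rfl
      -- The rank of z matters here: a flag ending strictly below z could survive the restriction,
      -- while the source is already zero.
      · rw [flagRestrict_comp_flagInclude_eq_zero hz hW hWZ, TensorProduct.map_zero_left] at key
        simp only [dif_pos hZ, dif_neg hW]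
        exact LinearMap.ext fun m => (LinearMap.congr_fun key (m ⟨hZ⟩)).symm
    · have hW : ¬ z ≤ IntervalPoset.pr₁ P W.unop := fun h => hZ (h.trans hWZ)
      simp only [dif_neg hZ, dif_neg hW]
      exact LinearMap.ext fun m =>
        (map_zero ((flagTensorSheaf G j).map f).hom : _ = (0 : (flagTensorSheaf G j).obj W)).symm

theorem tensorProduct_map_sum_left {ι V V' W W' : Type*} [AddCommGroup V] [Module ℚ V]
    [AddCommGroup V'] [Module ℚ V'] [AddCommGroup W] [Module ℚ W] [AddCommGroup W'] [Module ℚ W']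
    (s : Finset ι) (f : ι → V →ₗ[ℚ] V') (g : W →ₗ[ℚ] W') :
    TensorProduct.map (∑ i ∈ s, f i) g = ∑ i ∈ s, TensorProduct.map (f i) g :=
  map_sum ((TensorProduct.mapBilinear (RingHom.id ℚ) V W V' W').flip g) f s

open Classical in
theorem flagTensorProj_comp_flagTensorIncl_app (hz : Order.height z = j)
    (Z : (IntervalPoset P)ᵒᵖ) :
    ((flagTensorProj G j z ≫ flagTensorIncl G j z hz).app Z).hom =
      TensorProduct.map (if h : z ≤ IntervalPoset.pr₁ P Z.unop then
        flagInclude h j ∘ₗ flagRestrict h j else 0)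
        (LinearMap.id (R := ℚ) (M := (sheafPullback (IntervalPoset.pr₂ P) G).obj Z)) := by
  refine LinearMap.ext fun m => ?_
  change (ModuleCat.Hom.hom (ModuleCat.ofHom (dite _ _ _))) _ = _
  by_cases h : z ≤ IntervalPoset.pr₁ P Z.unop
  · simp only [dif_pos h]
    exact (LinearMap.congr_fun (TensorProduct.map_comp (flagInclude h j) LinearMap.id
      (flagRestrict h j) LinearMap.id) m).symm
  · simp only [dif_neg h]
    rw [TensorProduct.map_zero_left]
    rfl

/-- The identity of the sheaf is the sum over all z of rank j of the composites of projection and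
inclusion, and each of them factors through an acyclic direct image. -/
theorem isZero_sheafCohomology_flagTensorSheaf {q : ℕ} (hq : 0 < q) :
    IsZero (sheafCohomology q (flagTensorSheaf G j)) := by
  classical
  have := Fintype.ofFinite P
  have := rightDerived_additive (globalSections (IntervalPoset P)) q
  let s : Finset P := Finset.univ.filter fun z => Order.height z = j
  refine isZero_map_of_sum_comp_eq_id ((globalSections (IntervalPoset P)).rightDerived q)
    s.attach (K := fun z => flagTensorPart G j z) (fun z => flagTensorProj G j z)
    (fun z => flagTensorIncl G j z (Finset.mem_filter.1 z.2).2) ?_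
    fun z _ => isZero_sheafCohomology_upperPushforward _ _ hq
  ext Z : 2
  ext1
  rw [NatTrans.app_sum, ModuleCat.hom_sum]
  have key := tensorProduct_map_sum_left s
    (fun z => if h : z ≤ IntervalPoset.pr₁ P Z.unop then
      flagInclude h j ∘ₗ flagRestrict h j else 0)
    (LinearMap.id (R := ℚ) (M := (sheafPullback (IntervalPoset.pr₂ P) G).obj Z))
  rw [sum_flagInclude_comp_flagRestrict _ j s (by simp [s]), TensorProduct.map_id,
    ← Finset.sum_attach] at key
  refine Eq.trans (Finset.sum_congr rfl fun z _ => ?_) key.symm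
  exact flagTensorProj_comp_flagTensorIncl_app G j z.1 (Finset.mem_filter.1 z.2).2 Z

end Acyclic

/-! ## The contracting homotopy of the flag complex -/

section Homotopy

variable {P : Type u} [PartialOrder P]

/-- `J z` is the join of `a` and `z` in `P_{≤ x}`, and its rank is one more than the rank of `z`,
for all `z ≤ x` that are not above `a`. -/
structure IsRankedJoin (a x : P) (J : P → P) : Prop where
  not_isMin : ¬ IsMin a
  le {z : P} : z ≤ x → ¬ a ≤ z → J z ≤ x
  left_le {z : P} : z ≤ x → ¬ a ≤ z → a ≤ J z
  right_le {z : P} : z ≤ x → ¬ a ≤ z → z ≤ J z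
  min {z u : P} : z ≤ x → ¬ a ≤ z → u ≤ x → a ≤ u → z ≤ u → J z ≤ u
  height {z : P} : z ≤ x → ¬ a ≤ z → Order.height (J z) = Order.height z + 1

/-- Keep the elements of a flag up to the index `k`, and continue with the joins `J (z i)`, for all
indices `i ≥ k`. -/
def insertJoin (J : P → P) {j : ℕ} (k : Fin (j + 1)) (z : Fin (j + 1) → P) (l : Fin (j + 2)) : P :=
  if h : l.val ≤ k.val then z ⟨l.val, by omega⟩ else J (z ⟨l.val - 1, by omega⟩)

omit [PartialOrder P] in
theorem insertJoin_castSucc (J : P → P) {j : ℕ} {k : Fin (j + 1)} (z : Fin (j + 1) → P)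
    {i : Fin (j + 1)} (h : i ≤ k) : insertJoin J k z i.castSucc = z i :=
  dif_pos (show i.castSucc.val ≤ k.val from h)

omit [PartialOrder P] in
theorem insertJoin_succ (J : P → P) {j : ℕ} {k : Fin (j + 1)} (z : Fin (j + 1) → P)
    {i : Fin (j + 1)} (h : k ≤ i) : insertJoin J k z i.succ = J (z i) :=
  dif_neg (show ¬ i.succ.val ≤ k.val from fun h' => by
    have : k.val ≤ i.val := h
    simp at h'
    omega)

omit [PartialOrder P] in
theorem insertJoin_last_castSucc (J : P → P) {j : ℕ} (z : Fin (j + 1) → P) (l : Fin (j + 1)) :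
    insertJoin J (Fin.last j) z l.castSucc = z l :=
  insertJoin_castSucc J z (Fin.le_last l)

-- The entry at l depends on z at one index only: l in the lower part, l - 1 in the upper part. The
-- hypotheses ask that k' puts the entry in the same part and that z and z' agree at that index.
omit [PartialOrder P] in
theorem insertJoin_congr (J : P → P) {j : ℕ} (k k' : Fin (j + 1)) (z z' : Fin (j + 1) → P)
    (l : Fin (j + 2))
    (h₁ : ∀ i : Fin (j + 1), i ≤ k → i.val = l.val → i ≤ k' ∧ z i = z' i)
    (h₂ : ∀ i : Fin (j + 1), k ≤ i → i.val + 1 = l.val → k' ≤ i ∧ z i = z' i) :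
    insertJoin J k z l = insertJoin J k' z' l := by
  by_cases h : l.val ≤ k.val
  · obtain ⟨h', e⟩ := h₁ ⟨l.val, by omega⟩ h rfl
    rw [insertJoin, insertJoin, dif_pos h, dif_pos (show l.val ≤ k'.val from h'), e]
  · obtain ⟨h', e⟩ := h₂ ⟨l.val - 1, by omega⟩ (show k.val ≤ l.val - 1 by omega)
      (show l.val - 1 + 1 = l.val by omega)
    have h' : k'.val ≤ l.val - 1 := h'
    rw [insertJoin, insertJoin, dif_neg h, dif_neg (show ¬ l.val ≤ k'.val by omega), e]

/-! ### Insertion of joins into flags. -/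

variable {a x : P} {J : P → P}

theorem RankedFlag.not_le_of_not_le_last {j : ℕ} (Z : RankedFlag x j)
    (h : ¬ a ≤ Z.elt (Fin.last j)) (i : Fin (j + 1)) : ¬ a ≤ Z.elt i :=
  fun h' => h (h'.trans (Z.strictMono.monotone (Fin.le_last i)))

/-- Where a flag passes above a, its next element bounds both a and the current element, hence the
join; both have rank i + 1. -/
theorem IsRankedJoin.eq_of_not_le (hJ : IsRankedJoin a x J) {j : ℕ} (Z : RankedFlag x (j + 1))
    (i : Fin (j + 1)) (h : ¬ a ≤ Z.elt i.castSucc) (h' : a ≤ Z.elt i.succ) :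
    J (Z.elt i.castSucc) = Z.elt i.succ := by
  refine eq_of_le_of_height_eq_natCast (n := i + 1) (hJ.min (Z.le_top _) h (Z.le_top _) h'
    (Z.strictMono Fin.castSucc_lt_succ).le) ?_ (by simpa using Z.rank_eq i.succ)
  rw [hJ.height (Z.le_top _) h, Z.rank_eq]
  simp

/-- The flag obtained by inserting the joins with `a` from the index `k` on. -/
def RankedFlag.insert (hJ : IsRankedJoin a x J) {j : ℕ} (Z : RankedFlag x j)
    (k : Fin (j + 1)) (h : ¬ a ≤ Z.elt (Fin.last j)) : RankedFlag x (j + 1) :=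
  have hr : ∀ l, Order.height (insertJoin J k Z.elt l) = (l : ℕ) := fun l => by
    unfold insertJoin
    split_ifs with h'
    · exact Z.rank_eq _
    · rw [hJ.height (Z.le_top _) (Z.not_le_of_not_le_last h _), Z.rank_eq]
      have : l.val = l.val - 1 + 1 := by omega
      conv_rhs => rw [this]
      simp
  { elt := insertJoin J k Z.elt
    strictMono := by
      -- Weak monotonicity is enough, since consecutive entries have different ranks.
      refine Fin.strictMono_iff_lt_succ.2 fun i => lt_of_le_of_ne ?_ fun e => ?_
      · have hi := hJ.right_le (Z.le_top i) (Z.not_le_of_not_le_last h i)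
        rcases le_or_gt i k with hik | hik
        · rw [insertJoin_castSucc J _ hik]
          rcases hik.lt_or_eq with hlt | rfl
          · have : i.val < k.val := hlt
            obtain ⟨i', rfl⟩ : ∃ i' : Fin j, i = i'.castSucc := ⟨⟨i.val, by omega⟩, rfl⟩
            rw [← Fin.castSucc_succ, insertJoin_castSucc J _ (by
              simpa [Fin.le_def] using this)]
            exact Z.strictMono.monotone (Fin.castSucc_lt_succ).le
          · rwa [insertJoin_succ J _ le_rfl]
        · have : k.val < i.val := hik
          obtain ⟨i', hi'⟩ : ∃ i' : Fin j, i = i'.succ :=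
            ⟨⟨i.val - 1, by omega⟩, by ext; simp; omega⟩
          subst hi'
          rw [insertJoin_succ J _ hik.le, ← Fin.succ_castSucc, insertJoin_succ J _ (by
            simp only [Fin.val_succ] at this
            simp only [Fin.le_def, Fin.val_castSucc]
            omega)]
          refine hJ.min (Z.le_top _) (Z.not_le_of_not_le_last h _)
            (hJ.le (Z.le_top _) (Z.not_le_of_not_le_last h _))
            (hJ.left_le (Z.le_top _) (Z.not_le_of_not_le_last h _))
            ((Z.strictMono (Fin.castSucc_lt_succ)).le.trans hi)
      · have := congrArg Order.height e
        rw [hr, hr, Fin.val_castSucc, Fin.val_succ, ENat.natCast_inj] at this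
        omega
    rank_eq := hr
    le := by
      rw [← Fin.succ_last, insertJoin_succ J _ (Fin.le_last k)]
      exact hJ.le (Z.le_top _) (Z.not_le_of_not_le_last h _) }

/-! ### The contracting homotopy and its identities. -/

variable [Finite P]

/-- The contracting homotopy on flags, for the joins `J` with `a`. It is the transpose of the signed
sum of all insertions of joins with `a`. -/
def flagHomotopyAux (a x : P) (J : P → P) (j : ℕ) :
    (RankedFlag x (j + 1) →₀ ℚ) →ₗ[ℚ] (RankedFlag x j →₀ ℚ) :=
  Finsupp.linearCombination ℚ fun Y => ∑ k : Fin (j + 1),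
    (-1 : ℚ) ^ k.val • flagSum x j fun z => ¬ a ≤ z (Fin.last j) ∧ insertJoin J k z = Y.elt

/-- For fixed k, a flag z not reaching above a contributes to exactly one Y, its own insertion. So
the transpose acts on sums of flags by pulling the predicate back along insertion. -/
theorem flagHomotopyAux_flagSum (hJ : IsRankedJoin a x J) (j : ℕ)
    (p : (Fin (j + 2) → P) → Prop) :
    flagHomotopyAux a x J j (flagSum x (j + 1) p) = ∑ k : Fin (j + 1),
      (-1 : ℚ) ^ k.val • flagSum x j fun z => ¬ a ≤ z (Fin.last j) ∧ p (insertJoin J k z) := by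
  classical
  unfold flagHomotopyAux
  conv_lhs => rw [flagSum]
  simp only [map_sum, Finsupp.linearCombination_single, one_smul]
  rw [Finset.sum_comm]
  refine Finset.sum_congr rfl fun k _ => ?_
  rw [← Finset.smul_sum]
  congr 1
  unfold flagSum
  let g : RankedFlag x j → Option (RankedFlag x (j + 1)) := fun Z =>
    if h : ¬ a ≤ Z.elt (Fin.last j) then some (Z.insert hJ k h) else none
  rw [← Finset.sum_biUnion]
  · refine Finset.sum_congr ?_ fun _ _ => rfl
    ext Z
    simp only [Finset.mem_biUnion, Finset.mem_filter, Finset.mem_univ, true_and]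
    constructor
    · rintro ⟨Y, hY, h, e⟩
      exact ⟨h, e ▸ hY⟩
    · rintro ⟨h, hp⟩
      exact ⟨Z.insert hJ k h, hp, h, rfl⟩
  · intro Y _ Y' _ hne
    refine Finset.disjoint_left.2 fun Z hZ hZ' => hne (RankedFlag.ext ?_)
    simp only [Finset.mem_filter, Finset.mem_univ, true_and] at hZ hZ'
    rw [← hZ.2, ← hZ'.2]

/-- Apply the homotopy to the relation at index m. Insertions from m - 1 and from m differ only in
the entry at m, which the relation ignores, so these two terms cancel. For every other k the
condition ignores one interior entry of z, and the term is a sum of relations. -/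
theorem flagHomotopyAux_mem (hJ : IsRankedJoin a x J) (j : ℕ)
    (v : RankedFlag x (j + 1) →₀ ℚ) (hv : v ∈ flagRelations x (j + 1)) :
    flagHomotopyAux a x J j v ∈ flagRelations x j := by
  suffices h : flagRelations x (j + 1) ≤
      (flagRelations x j).comap (flagHomotopyAux a x J j) from h hv
  refine Submodule.span_le.2 ?_
  rintro _ ⟨Y, m, h0, hm, rfl⟩
  change flagHomotopyAux a x J j _ ∈ flagRelations x j
  have h0 : 0 < m.val := h0
  have hm : m.val < j + 1 := hm
  rw [flagHomotopyAux_flagSum hJ, ← Submodule.Quotient.mk_eq_zero, ← Submodule.mkQ_apply,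
    map_sum, Fintype.sum_eq_add (⟨m.val - 1, by omega⟩ : Fin (j + 1)) ⟨m.val, hm⟩]
  · rw [map_smul, map_smul]
    have e : (-1 : ℚ) ^ m.val = - (-1 : ℚ) ^ (m.val - 1) := by
      conv_lhs => rw [show m.val = m.val - 1 + 1 by omega, pow_succ]
      ring
    simp only [e, neg_smul]
    rw [← sub_eq_add_neg, sub_eq_zero]
    congr 2
    refine flagSum_congr fun Z => and_congr_right fun _ => forall₂_congr fun l hl => ?_
    have hl : l.val ≠ m.val := fun h => hl (Fin.ext h)
    rw [insertJoin_congr J _ ⟨m.val, hm⟩ Z.elt Z.elt l]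
    · intro i hi _
      have : i.val ≤ m.val - 1 := hi
      exact ⟨show i.val ≤ m.val by omega, rfl⟩
    · intro i hi _
      have : m.val - 1 ≤ i.val := hi
      exact ⟨show m.val ≤ i.val by omega, rfl⟩
  · intro h
    have := congrArg Fin.val h
    simp only at this
    omega
  · rintro k ⟨hk, hk'⟩
    have hk : k.val ≠ m.val - 1 := fun h => hk (Fin.ext h)
    have hk' : k.val ≠ m.val := fun h => hk' (Fin.ext h)
    rw [map_smul, Submodule.mkQ_apply, (Submodule.Quotient.mk_eq_zero _).2, smul_zero]
    rcases lt_or_ge m.val k.val with hmk | hmk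
    -- For k > m the element z_m occurs only as the ignored entry at m.
    · refine flagSum_mem _ ⟨m.val, hm⟩ h0 (show m.val < j by omega) ?_
      rintro z z' hz ⟨h, hp⟩
      refine ⟨hz (Fin.last j) (fun e => ?_) ▸ h, fun l hl => ?_⟩
      · have : j = m.val := congrArg Fin.val e
        omega
      · rw [← hp l hl]
        have hl : l.val ≠ m.val := fun h => hl (Fin.ext h)
        refine insertJoin_congr J _ _ _ _ _ (fun i hi e => ⟨hi, (hz i fun e' => ?_).symm⟩)
          (fun i hi e => ⟨hi, (hz i fun e' => ?_).symm⟩)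
        · have : i.val = m.val := congrArg Fin.val e'
          omega
        · have : i.val = m.val := congrArg Fin.val e'
          have : k.val ≤ i.val := hi
          omega
    -- For k < m - 1 the element z_{m-1} occurs only through its join, at the ignored entry m.
    · refine flagSum_mem _ ⟨m.val - 1, by omega⟩ (show 0 < m.val - 1 by omega)
        (show m.val - 1 < j by omega) ?_
      rintro z z' hz ⟨h, hp⟩
      refine ⟨hz (Fin.last j) (fun e => ?_) ▸ h, fun l hl => ?_⟩
      · have : j = m.val - 1 := congrArg Fin.val e
        omega
      · rw [← hp l hl]
        have hl : l.val ≠ m.val := fun h => hl (Fin.ext h)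
        refine insertJoin_congr J _ _ _ _ _ (fun i hi e => ⟨hi, (hz i fun e' => ?_).symm⟩)
          (fun i hi e => ⟨hi, (hz i fun e' => ?_).symm⟩)
        · have : i.val = m.val - 1 := congrArg Fin.val e'
          have : i.val ≤ k.val := hi
          omega
        · have : i.val = m.val - 1 := congrArg Fin.val e'
          omega

/-- The contracting homotopy on flag spaces. -/
def flagHomotopy (hJ : IsRankedJoin a x J) (j : ℕ) :
    FlagSpace x (j + 1) →ₗ[ℚ] FlagSpace x j :=
  Submodule.mapQ _ _ (flagHomotopyAux a x J j) (flagHomotopyAux_mem hJ j)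

/-- Dropping the inserted join from z_0 < J z_0 gives back z_0. No flag of length zero is excluded,
as its element is minimal and a is not. -/
theorem flagHomotopy_comp_flagDiff_zero (hJ : IsRankedJoin a x J) :
    flagHomotopy hJ 0 ∘ₗ flagDiff x 0 = LinearMap.id := by
  refine flagSpace_hom_ext fun Y => ?_
  change Submodule.Quotient.mk (flagHomotopyAux a x J 0 (flagDiffAux x 0 _)) = _
  rw [flagDiffAux_flagSum, map_smul, flagHomotopyAux_flagSum hJ]
  rw [Fin.sum_univ_succ, Finset.univ_eq_empty, Finset.sum_empty, add_zero]
  simp only [pow_zero, Fin.val_zero, one_smul, LinearMap.id_apply]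
  refine congrArg _ (flagSum_congr fun Z => ⟨fun h => ?_, fun h => ⟨fun h' => ?_, ?_⟩⟩)
  · exact funext fun l => (insertJoin_last_castSucc J Z.elt l).symm.trans (congrFun h.2 l)
  · have h0 : Order.height (Z.elt (Fin.last 0)) = 0 := by simpa using Z.rank_eq (Fin.last 0)
    exact hJ.not_isMin ((Order.height_eq_zero.1 h0).mono h')
  · exact funext fun l => (insertJoin_last_castSucc J Z.elt l).trans (congrFun h l)

/-- The flags that agree with `Y` up to the index `m` and after the index `t`, such that the
elements up to the index `t` are not above `a`, and the elements between have the joins `Y`. -/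
def IsPartialInsert (a : P) (J : P → P) {j : ℕ} (Y : Fin (j + 2) → P) (m t : ℕ)
    (z : Fin (j + 2) → P) : Prop :=
  (∀ i : Fin (j + 2), i.val ≤ m ∨ t < i.val → z i = Y i) ∧
    (∀ i : Fin (j + 1), m ≤ i.val → i.val < t → J (z i.castSucc) = Y i.succ) ∧
      ∀ i : Fin (j + 2), i.val ≤ t → ¬ a ≤ z i

/-- Both conditions arise by splitting one condition `p` that leaves the entry at t + 1 free, and so
has zero class. If that entry is above a, it is J (z t) = Y (t + 1), which gives the condition for
t; otherwise the condition for t + 1 results. -/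
theorem mk_flagSum_isPartialInsert_succ (hJ : IsRankedJoin a x J) {j : ℕ}
    (Y : RankedFlag x (j + 1)) (m t : ℕ) (hmt : m ≤ t) (htj : t < j)
    (hY : ∀ i : Fin (j + 2), m < i.val → a ≤ Y.elt i) :
    (flagRelations x (j + 1)).mkQ (flagSum x (j + 1) (IsPartialInsert a J Y.elt m (t + 1))) =
      - (flagRelations x (j + 1)).mkQ (flagSum x (j + 1) (IsPartialInsert a J Y.elt m t)) := by
  let p : (Fin (j + 2) → P) → Prop := fun z =>
    (∀ i : Fin (j + 2), i.val ≤ m ∨ t + 1 < i.val → z i = Y.elt i) ∧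
    (∀ i : Fin (j + 1), m ≤ i.val → i.val < t + 1 → J (z i.castSucc) = Y.elt i.succ) ∧
      ∀ i : Fin (j + 2), i.val ≤ t → ¬ a ≤ z i
  let q : (Fin (j + 2) → P) → Prop := fun z => a ≤ z ⟨t + 1, by omega⟩
  have hp : (flagRelations x (j + 1)).mkQ (flagSum x (j + 1) p) = 0 := by
    rw [Submodule.mkQ_apply, Submodule.Quotient.mk_eq_zero]
    refine flagSum_mem _ ⟨t + 1, by omega⟩ (show 0 < t + 1 by omega)
      (show t + 1 < j + 1 by omega) ?_
    rintro z z' hz ⟨h₁, h₂, h₃⟩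
    have hz : ∀ i : Fin (j + 2), i.val ≠ t + 1 → z i = z' i :=
      fun i hi => hz i fun e => hi (congrArg Fin.val e)
    refine ⟨fun i hi => ?_, fun i hi hi' => ?_, fun i hi => ?_⟩
    · rw [← hz i (by omega), h₁ i hi]
    · rw [← hz _ (by simp; omega), h₂ i hi hi']
    · rw [← hz i (by omega)]
      exact h₃ i hi
  rw [flagSum_eq_add p q, map_add] at hp
  rw [eq_neg_iff_add_eq_zero]
  refine (add_comm _ _).trans (Eq.trans ?_ hp)
  congr 2
  · refine flagSum_congr fun Z => ⟨fun ⟨h₁, h₂, h₃⟩ => ⟨⟨fun i hi => h₁ i (by omega),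
      fun i hi hi' => ?_, h₃⟩, ?_⟩, fun ⟨⟨h₁, h₂, h₃⟩, h⟩ => ⟨fun i hi => ?_,
        fun i hi hi' => h₂ i hi (by omega), h₃⟩⟩
    · rcases Nat.lt_succ_iff_lt_or_eq.1 hi' with hlt | heq
      · exact h₂ i hi hlt
      · have e := h₁ i.succ (by simp; omega)
        rw [← e]
        refine hJ.eq_of_not_le Z i (h₃ _ (by simp; omega)) ?_
        rw [e]
        exact hY _ (by simp; omega)
    · change a ≤ Z.elt _
      rw [h₁ _ (by simp)]
      exact hY _ (by simp; omega)
    · by_cases hit : i.val = t + 1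
      · obtain ⟨i', rfl⟩ : ∃ i' : Fin (j + 1), i = i'.succ :=
          ⟨⟨i.val - 1, by omega⟩, by ext; simp; omega⟩
        rw [← h₂ i' (by simp at hit; omega) (by simp at hit; omega)]
        refine (hJ.eq_of_not_le Z i' (h₃ _ (by simp at hit ⊢; omega)) ?_).symm
        have : i'.succ = ⟨t + 1, by omega⟩ := Fin.ext hit
        rw [this]
        exact h
      · exact h₁ i (by omega)
  · refine flagSum_congr fun Z => ⟨fun ⟨h₁, h₂, h₃⟩ => ⟨⟨h₁, h₂, fun i hi => h₃ i (by omega)⟩,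
      h₃ _ (by simp)⟩, fun ⟨⟨h₁, h₂, h₃⟩, h⟩ => ⟨h₁, h₂, fun i hi => ?_⟩⟩
    by_cases hit : i.val = t + 1
    · have : i = ⟨t + 1, by omega⟩ := Fin.ext hit
      rw [this]
      exact h
    · exact h₃ i (by omega)

/-- Here m is the last index at which Y is not above a. For t = m the only flag is Y itself, and
each further step changes the sign. -/
theorem mk_flagSum_isPartialInsert (hJ : IsRankedJoin a x J) {j : ℕ}
    (Y : RankedFlag x (j + 1)) (m : ℕ) (hY : ∀ i : Fin (j + 2), m < i.val ↔ a ≤ Y.elt i)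
    (t : ℕ) (hmt : m ≤ t) (htj : t ≤ j) :
    (flagRelations x (j + 1)).mkQ (flagSum x (j + 1) (IsPartialInsert a J Y.elt m t)) =
      (-1 : ℚ) ^ (m + t) •
        (flagRelations x (j + 1)).mkQ (flagSum x (j + 1) fun z => z = Y.elt) := by
  induction t, hmt using Nat.le_induction with
  | base =>
    rw [← two_mul, pow_mul, neg_one_sq, one_pow, one_smul]
    refine congrArg _ (flagSum_congr fun Z => ⟨fun ⟨h₁, _, _⟩ => funext fun i => h₁ i (by omega),
      fun h => ⟨fun i _ => by rw [h], fun i hi hi' => by omega, fun i hi => ?_⟩⟩)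
    rw [h, ← hY]
    omega
  | succ t hmt ih =>
    rw [mk_flagSum_isPartialInsert_succ hJ Y m t hmt htj fun i hi => (hY i).1 hi, ih (by omega),
      ← add_assoc, pow_succ, mul_neg_one, neg_smul]

/-- This is the partial insertion with t = j: the top element of z is above a and the one before is
not, so the top element is their join, the top of Y. -/
theorem mk_flagSum_insertJoin (hJ : IsRankedJoin a x J) {j : ℕ}
    (Y : RankedFlag x (j + 1)) (m : Fin (j + 1))
    (hY : ∀ i : Fin (j + 2), m.val < i.val ↔ a ≤ Y.elt i) :
    (flagRelations x (j + 1)).mkQ (flagSum x (j + 1) fun z =>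
      (¬ a ≤ z (Fin.last j).castSucc ∧ insertJoin J m (fun i => z i.castSucc) = Y.elt) ∧
        a ≤ z (Fin.last (j + 1))) =
      (-1 : ℚ) ^ (m.val + j) •
        (flagRelations x (j + 1)).mkQ (flagSum x (j + 1) fun z => z = Y.elt) := by
  rw [← mk_flagSum_isPartialInsert hJ Y m hY j (by omega) le_rfl]
  refine congrArg _ (flagSum_congr fun Z => ⟨fun ⟨⟨h₁, h₂⟩, h₃⟩ => ?_, fun ⟨h₁, h₂, h₃⟩ => ?_⟩)
  · have hi' : ∀ i : Fin (j + 1), m ≤ i → J (Z.elt i.castSucc) = Y.elt i.succ := fun i hi => by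
      rw [← h₂, insertJoin_succ J _ hi]
    refine ⟨fun i hi => ?_, fun i hi _ => hi' i hi, fun i hi h => h₁ (h.trans ?_)⟩
    · rcases hi with hi | hi
      · obtain ⟨i', rfl⟩ : ∃ i' : Fin (j + 1), i = i'.castSucc := ⟨⟨i.val, by omega⟩, rfl⟩
        rw [← h₂, insertJoin_castSucc J _ (show i'.val ≤ m.val from hi)]
      · obtain rfl : i = Fin.last (j + 1) := Fin.ext (by simp; omega)
        rw [← Fin.succ_last] at h₃ ⊢
        rw [← hi' _ (Fin.le_last m), hJ.eq_of_not_le Z _ h₁ h₃]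
    · exact Z.strictMono.monotone (show i.val ≤ j from hi)
  · have hl : Z.elt (Fin.last j).succ = Y.elt (Fin.last j).succ := h₁ _ (by simp)
    have ha : a ≤ Z.elt (Fin.last j).succ := by
      rw [hl]
      exact (hY _).1 (by simp; omega)
    have hn : ¬ a ≤ Z.elt (Fin.last j).castSucc := h₃ _ (by simp)
    refine ⟨⟨hn, funext fun l => ?_⟩, ha⟩
    by_cases hlm : l.val ≤ m.val
    · obtain ⟨i, rfl⟩ : ∃ i : Fin (j + 1), l = i.castSucc := ⟨⟨l.val, by omega⟩, rfl⟩
      rw [insertJoin_castSucc J _ (show i.val ≤ m.val from hlm)]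
      exact h₁ _ (Or.inl hlm)
    · obtain ⟨i, rfl⟩ : ∃ i : Fin (j + 1), l = i.succ :=
        ⟨⟨l.val - 1, by omega⟩, by ext; simp; omega⟩
      have hmi : m.val ≤ i.val := by
        simp at hlm
        omega
      rw [insertJoin_succ J _ hmi]
      rcases (Fin.le_last i).lt_or_eq with hlt | rfl
      · exact h₂ i hmi hlt
      · rw [hJ.eq_of_not_le Z _ hn ha, hl]

/-- Truncation commutes with insertion from k ≤ j, so flags whose top is not above a cancel between
the two composites. What is left is `T`, from the insertion at the very end, and the sums `S k` over
flags whose top is above a. Exactly one of these represents Y, according to whether the top of Y is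
above a; the others vanish. -/
theorem flagDiff_comp_flagHomotopy_add (hJ : IsRankedJoin a x J) (j : ℕ) :
    flagDiff x j ∘ₗ flagHomotopy hJ j +
      flagHomotopy hJ (j + 1) ∘ₗ flagDiff x (j + 1) = LinearMap.id := by
  refine flagSpace_hom_ext fun Y => ?_
  let S : Fin (j + 1) → RankedFlag x (j + 1) →₀ ℚ := fun k => flagSum x (j + 1) fun z =>
      (¬ a ≤ z (Fin.last j).castSucc ∧ insertJoin J k (fun i => z i.castSucc) = Y.elt) ∧
        a ≤ z (Fin.last (j + 1))
  let T : RankedFlag x (j + 1) →₀ ℚ := flagSum x (j + 1) fun z =>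
      ¬ a ≤ z (Fin.last (j + 1)) ∧ z = Y.elt
  have key : flagDiffAux x j (flagHomotopyAux a x J j (flagSum x (j + 1) fun z => z = Y.elt)) +
      flagHomotopyAux a x J (j + 1) (flagDiffAux x (j + 1) (flagSum x (j + 1) fun z => z = Y.elt)) =
      T + ∑ k : Fin (j + 1), (-1 : ℚ) ^ (k.val + j) • S k := by
    rw [flagHomotopyAux_flagSum hJ, flagDiffAux_flagSum, map_smul,
      flagHomotopyAux_flagSum hJ, map_sum, Fin.sum_univ_castSucc (n := j + 1), smul_add, add_comm T,
      ← add_assoc]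
    congr 1
    · rw [Finset.smul_sum, ← Finset.sum_add_distrib]
      refine Finset.sum_congr rfl fun k _ => ?_
      rw [map_smul, flagDiffAux_flagSum, smul_smul, smul_smul, ← pow_add, ← pow_add,
        flagSum_eq_add _ fun z => a ≤ z (Fin.last (j + 1)), smul_add, add_assoc, add_eq_left,
        Fin.val_castSucc, show j + 1 + k.val = k.val + j + 1 by ring, pow_succ, mul_neg_one,
        neg_smul, ← sub_eq_add_neg, sub_eq_zero]
      refine congrArg _ (flagSum_congr fun Z => ⟨fun ⟨⟨h₁, h₂⟩, h₃⟩ => ⟨h₃, ?_⟩,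
        fun ⟨h₁, h₂⟩ => ⟨⟨Z.not_le_of_not_le_last h₁ _, ?_⟩, h₁⟩⟩)
      · exact h₂
      · exact h₂
    · rw [smul_smul, ← pow_add, Fin.val_last, ← two_mul, pow_mul, neg_one_sq, one_pow, one_smul]
      refine flagSum_congr fun Z => and_congr_right fun _ => ?_
      exact Eq.congr_left (funext fun l => insertJoin_last_castSucc J Z.elt l)
  have key' := congrArg (flagRelations x (j + 1)).mkQ key
  rw [map_add] at key'
  refine key'.trans ?_
  rw [map_add, map_sum, LinearMap.id_apply]
  -- A nonzero `S k` forces Y to pass above a between the indices k and k + 1.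
  have hmem : ∀ k (Z : RankedFlag x (j + 1)), (¬ a ≤ Z.elt (Fin.last j).castSucc ∧
      insertJoin J k (fun i => Z.elt i.castSucc) = Y.elt) ∧ a ≤ Z.elt (Fin.last (j + 1)) →
      ¬ a ≤ Y.elt k.castSucc ∧ a ≤ Y.elt k.succ := by
    rintro k Z ⟨⟨h₁, h₂⟩, -⟩
    have hk := Z.truncate.not_le_of_not_le_last h₁ k
    rw [← h₂, insertJoin_castSucc J _ le_rfl, insertJoin_succ J _ le_rfl]
    exact ⟨hk, hJ.left_le (Z.truncate.le_top k) hk⟩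
  by_cases h : a ≤ Y.elt (Fin.last (j + 1))
  · have hT : T = 0 := flagSum_eq_zero fun Z hZ => hZ.1 (hZ.2 ▸ h)
    obtain ⟨m, hm⟩ : ∃ m : Fin (j + 1), ∀ i : Fin (j + 2), m.val < i.val ↔ a ≤ Y.elt i := by
      classical
      let s := Finset.univ.filter fun i : Fin (j + 2) => a ≤ Y.elt i
      have hs : s.Nonempty := ⟨Fin.last (j + 1), by simpa [s] using h⟩
      have hn : a ≤ Y.elt (s.min' hs) := (Finset.mem_filter.1 (s.min'_mem hs)).2
      -- The first index above a is positive, since the element of rank zero cannot be above a; its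
      -- predecessor is m.
      have h0 : (s.min' hs).val ≠ 0 := fun h0 => by
        have h0 : Order.height (Y.elt (s.min' hs)) = 0 := by rw [Y.rank_eq, h0]; rfl
        exact hJ.not_isMin ((Order.height_eq_zero.1 h0).mono hn)
      refine ⟨⟨(s.min' hs).val - 1, by omega⟩, fun i => ⟨fun hi => hn.trans
        (Y.strictMono.monotone (show (s.min' hs).val ≤ i.val by simp only at hi; omega)),
          fun hi => ?_⟩⟩
      have : (s.min' hs).val ≤ i.val := s.min'_le i (by simpa [s] using hi)
      simp only
      omega
    rw [hT, map_zero, zero_add, Fintype.sum_eq_single m]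
    · rw [map_smul, mk_flagSum_insertJoin hJ Y m hm, smul_smul, ← pow_add, ← two_mul, pow_mul,
        neg_one_sq, one_pow, one_smul]
      rfl
    · intro k hk
      rw [show S k = 0 from flagSum_eq_zero fun Z hZ => ?_, smul_zero, map_zero]
      obtain ⟨h₁, h₂⟩ := hmem k Z hZ
      rw [← hm] at h₁ h₂
      refine hk (Fin.ext ?_)
      simp at h₁ h₂
      omega
  · have hS : ∀ k, S k = 0 := fun k => flagSum_eq_zero fun Z hZ =>
      h ((hmem k Z hZ).2.trans (Y.strictMono.monotone (Fin.le_last _)))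
    simp only [hS, smul_zero, map_zero, Finset.sum_const_zero, add_zero]
    refine congrArg Submodule.Quotient.mk (flagSum_congr fun Z => and_iff_right_of_imp ?_)
    rintro hZ
    rwa [hZ]

end Homotopy

/-! ## The flag resolution -/

section Resolution

variable {P : Type u} [PartialOrder P] [Finite P]

theorem flagSpace_subsingleton (x : P) (j : ℕ) (h : IsEmpty (RankedFlag x j)) :
    Subsingleton (FlagSpace x j) :=
  (Submodule.Quotient.mk_surjective _).subsingleton

theorem tensorProduct_subsingleton_left (V W : Type*) [AddCommGroup V] [Module ℚ V]
    [AddCommGroup W] [Module ℚ W] [Subsingleton V] : Subsingleton (V ⊗[ℚ] W) :=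
  subsingleton_of_forall_eq 0 fun t => by
    induction t using TensorProduct.induction_on with
    | zero => rfl
    | tmul v w => rw [Subsingleton.elim v 0, TensorProduct.zero_tmul]
    | add s t hs ht => rw [hs, ht, add_zero]

omit [Finite P] in
theorem isEmpty_rankedFlag_bot [OrderBot P] (j : ℕ) : IsEmpty (RankedFlag (⊥ : P) (j + 1)) :=
  ⟨fun Y => by
    have := Y.rank_eq (Fin.last (j + 1))
    rw [le_bot_iff.1 Y.le, Order.height_bot, Fin.val_last] at this
    exact absurd this.symm (by simp)⟩

theorem exists_eq_smul_botFlag [OrderBot P] (x : P) (f : FlagSpace x 0) :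
    ∃ c : ℚ, f = c • botFlag x := by
  suffices h : ∀ f : RankedFlag x 0 →₀ ℚ,
      ∃ c : ℚ, (Submodule.Quotient.mk f : FlagSpace x 0) = c • botFlag x by
    obtain ⟨f, rfl⟩ := Submodule.Quotient.mk_surjective _ f
    exact h f
  intro f
  induction f using Finsupp.induction_linear with
  | zero => exact ⟨0, by simp⟩
  | add f g hf hg =>
    obtain ⟨c, hc⟩ := hf
    obtain ⟨d, hd⟩ := hg
    exact ⟨c + d, by rw [Submodule.Quotient.mk_add, hc, hd, add_smul]⟩
  | single Y c =>
    refine ⟨c, ?_⟩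
    rw [botFlag, ← Submodule.Quotient.mk_smul, Finsupp.smul_single_one]
    congr 2
    refine RankedFlag.ext (funext fun k => ?_)
    have := Y.rank_eq k
    rw [Fin.fin_one_eq_zero k] at this ⊢
    exact isMin_iff_eq_bot.1 (Order.height_eq_zero.1 (by simpa using this))

/-- The linear form on `Fl^0(P_{≤ x})` that counts flags. -/
def flagCounit (x : P) : FlagSpace x 0 →ₗ[ℚ] ℚ :=
  Submodule.liftQ _ (Finsupp.linearCombination ℚ fun _ => (1 : ℚ)) <| by
    refine Submodule.span_le.2 ?_
    rintro _ ⟨Y, k, h0, hk, rfl⟩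
    exact absurd (h0.trans hk) (by simp)

theorem flagCounit_botFlag [OrderBot P] (x : P) : flagCounit x (botFlag x) = 1 := by
  change Finsupp.linearCombination ℚ (fun _ => (1 : ℚ)) (Finsupp.single _ 1) = 1
  simp

/-! ### Exactness of the augmented complex on stalks. -/

section Stalks

variable [OrderBot P] (x : P) (V : Type u) [AddCommGroup V] [Module ℚ V]

theorem augmentationStalk_injective : Function.Injective (augmentationStalk x V) := by
  intro m m' h
  funext hx
  rw [augmentationStalk_pos V hx.down, augmentationStalk_pos V hx.down] at h
  have := congrArg ((TensorProduct.lid ℚ V).toLinearMap ∘ₗ (flagCounit x).rTensor V) h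
  simpa [flagCounit_botFlag] using this

theorem flagDiff_augmentationStalk (m : PLift (x = ⊥) → V) :
    (flagDiff x 0).rTensor V (augmentationStalk x V m) = 0 := by
  by_cases hx : x = ⊥
  · subst hx
    have := flagSpace_subsingleton (⊥ : P) 1 (isEmpty_rankedFlag_bot 0)
    have := tensorProduct_subsingleton_left (FlagSpace (⊥ : P) 1) V
    exact Subsingleton.elim _ _
  · rw [augmentationStalk_neg V hx, LinearMap.zero_apply, map_zero]

variable {x V}

/-- At x = ⊥ the space Fl^0 is spanned by the flag (⊥). Elsewhere the homotopy is a left inverse of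
δ in degree zero, so the kernel is zero. -/
theorem exists_augmentationStalk_eq (hx : x ≠ ⊥ → ∃ a J, IsRankedJoin a x J)
    (t : FlagSpace x 0 ⊗[ℚ] V) (ht : (flagDiff x 0).rTensor V t = 0) :
    ∃ m, augmentationStalk x V m = t := by
  by_cases h : x = ⊥
  · have hm : ∃ v : V, botFlag x ⊗ₜ v = t := by
      clear ht
      induction t using TensorProduct.induction_on with
      | zero => exact ⟨0, TensorProduct.tmul_zero _ _⟩
      | tmul f v =>
        obtain ⟨c, rfl⟩ := exists_eq_smul_botFlag x f
        exact ⟨c • v, by rw [TensorProduct.smul_tmul]⟩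
      | add s t hs ht =>
        obtain ⟨v, rfl⟩ := hs
        obtain ⟨w, rfl⟩ := ht
        exact ⟨v + w, TensorProduct.tmul_add _ _ _⟩
    obtain ⟨v, rfl⟩ := hm
    exact ⟨fun _ => v, augmentationStalk_pos V h _⟩
  · obtain ⟨a, J, hJ⟩ := hx h
    refine ⟨0, ?_⟩
    have := congrArg ((flagHomotopy hJ 0).rTensor V) ht
    rw [← LinearMap.comp_apply, ← LinearMap.rTensor_comp, flagHomotopy_comp_flagDiff_zero,
      LinearMap.rTensor_id, LinearMap.id_apply, map_zero] at this
    rw [this, map_zero]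

/-- The homotopy identity survives tensoring with V, so the homotopy provides a preimage of a
cocycle. -/
theorem exists_flagDiff_rTensor_eq (hx : x ≠ ⊥ → ∃ a J, IsRankedJoin a x J) (j : ℕ)
    (t : FlagSpace x (j + 1) ⊗[ℚ] V) (ht : (flagDiff x (j + 1)).rTensor V t = 0) :
    ∃ s, (flagDiff x j).rTensor V s = t := by
  by_cases h : x = ⊥
  · subst h
    have := flagSpace_subsingleton (⊥ : P) (j + 1) (isEmpty_rankedFlag_bot j)
    have := tensorProduct_subsingleton_left (FlagSpace (⊥ : P) (j + 1)) V
    exact ⟨0, Subsingleton.elim _ _⟩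
  · obtain ⟨a, J, hJ⟩ := hx h
    refine ⟨(flagHomotopy hJ j).rTensor V t, ?_⟩
    have := congrArg (fun f => f.rTensor V t) (flagDiff_comp_flagHomotopy_add hJ j)
    simpa [LinearMap.rTensor_add, LinearMap.rTensor_comp, ht] using this

end Stalks

variable (G : PosetSheaf Pᵒᵈ)

theorem flagTensorComplex_d_app (j : ℕ) (Z : (IntervalPoset P)ᵒᵖ) :
    (((flagTensorComplex P G).d j (j + 1)).app Z).hom =
      (flagDiff (IntervalPoset.pr₁ P Z.unop) j).rTensor
        ((sheafPullback (IntervalPoset.pr₂ P) G).obj Z) := by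
  have h := CochainComplex.of_d (fun j => flagTensorSheaf G j) (fun j => tensorSheafMap
    (Functor.whiskerLeft (IntervalPoset.pr₁ P).monotone.functor.op (flagSheafDiff P j))
    (sheafPullback (IntervalPoset.pr₂ P) G)) j
  exact congrArg (fun f : flagTensorSheaf G j ⟶ flagTensorSheaf G (j + 1) => (f.app Z).hom) h

theorem isZero_flagTensorComplex_X {n : ℕ∞} (hn : ∀ x : P, Order.height x ≤ n) (j : ℕ)
    (hj : n < j) : IsZero ((flagTensorComplex P G).X j) := by
  rw [Functor.isZero_iff]
  intro Z
  have := flagSpace_subsingleton (IntervalPoset.pr₁ P Z.unop) j ⟨fun Y => by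
    have := hn (Y.elt (Fin.last j))
    rw [Y.rank_eq, Fin.val_last] at this
    exact this.not_gt hj⟩
  have := tensorProduct_subsingleton_left (FlagSpace (IntervalPoset.pr₁ P Z.unop) j)
    ((sheafPullback (IntervalPoset.pr₂ P) G).obj Z)
  exact ModuleCat.isZero_of_subsingleton (ModuleCat.of ℚ
    (FlagSpace (IntervalPoset.pr₁ P Z.unop) j ⊗[ℚ] (sheafPullback (IntervalPoset.pr₂ P) G).obj Z))

/-- The tensor product of the flag resolution with a sheaf on the opposite poset is an acyclic
resolution, provided that all principal order ideals have joins with some element which raise the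
rank by one. -/
theorem isGammaAcyclicResolution_flagTensorComplex [OrderBot P]
    (hP : ∀ x : P, x ≠ ⊥ → ∃ a J, IsRankedJoin a x J) :
    IsGammaAcyclicResolution (extendByZero G) (flagTensorComplex P G) (augmentation G) where
  comp_eq_zero := by
    ext Z : 2
    ext1
    rw [NatTrans.comp_app, ModuleCat.hom_comp, flagTensorComplex_d_app]
    exact LinearMap.ext fun m => flagDiff_augmentationStalk _ _ m
  mono := by
    have : ∀ Z, Mono ((augmentation G).app Z) := fun Z =>
      (ModuleCat.mono_iff_injective _).2 (augmentationStalk_injective _ _)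
    exact NatTrans.mono_of_mono_app _
  exact_zero := by
    refine exact_of_exact_evaluation _ fun Z =>
      (ShortComplex.moduleCat_exact_iff _).2 fun t ht => ?_
    exact exists_augmentationStalk_eq (hP _) t
      ((LinearMap.congr_fun (flagTensorComplex_d_app G 0 Z) t).symm.trans ht)
  exact_succ j := by
    rw [HomologicalComplex.exactAt_iff' _ j (j + 1) (j + 2) (by simp) (by simp)]
    refine exact_of_exact_evaluation _ fun Z =>
      (ShortComplex.moduleCat_exact_iff _).2 fun t ht => ?_
    obtain ⟨s, hs⟩ := exists_flagDiff_rTensor_eq (hP _) j t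
      ((LinearMap.congr_fun (flagTensorComplex_d_app G (j + 1) Z) t).symm.trans ht)
    exact ⟨s, (LinearMap.congr_fun (flagTensorComplex_d_app G j Z) s).trans hs⟩
  acyclic j q hq := isZero_sheafCohomology_flagTensorSheaf G j hq

end Resolution

/-! ## Ranks in semimodular lattices -/

theorem height_ne_top_of_finite {P : Type*} [PartialOrder P] [Finite P] (x : P) :
    Order.height x ≠ ⊤ := fun h => by
  obtain ⟨s, -, hs⟩ := Order.height_eq_top_iff.1 h (Nat.card P)
  have := Nat.card_le_card_of_injective s s.strictMono.injective
  rw [Nat.card_fin, hs] at this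
  omega

theorem coheight_ne_top_of_finite {P : Type*} [PartialOrder P] [Finite P] (x : P) :
    Order.coheight x ≠ ⊤ :=
  height_ne_top_of_finite (OrderDual.toDual x)

section Semimodular

variable {M : Type u} [Lattice M] [BoundedOrder M] [Finite M] [IsUpperModularLattice M]

/-- Let f be a cover of e on a longest chain going up. If f ≠ e', then f ⊓ e' = e, and by
semimodularity f ⊔ e' covers both. Induction from the top then gives f and e' the same coheight. -/
theorem coheight_eq_add_one_of_covBy {e e' : M} (h : e ⋖ e') :
    Order.coheight e = Order.coheight e' + 1 := by
  induction e using WellFoundedGT.induction generalizing e' with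
  | ind e ih =>
    obtain ⟨k, hk⟩ : ∃ k : ℕ, Order.coheight e = k + 1 := by
      obtain ⟨n, hn⟩ := ENat.ne_top_iff_exists.1 (coheight_ne_top_of_finite e)
      have := Order.coheight_add_one_le h.lt
      cases n with
      | zero => exact absurd (this.trans hn.symm.le) (by simp)
      | succ n => exact ⟨n, hn.symm⟩
    obtain ⟨f, hf, hfk⟩ := (Order.coheight_eq_coe_add_one_iff.1 hk).2.1
    have hef : e ⋖ f := ⟨hf, fun g hg hgf => by
      have h₁ := Order.coheight_add_one_le hg
      have h₂ := Order.coheight_add_one_le hgf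
      rw [hk] at h₁
      rw [hfk] at h₂
      have := (add_le_add_left h₂ 1).trans h₁
      norm_cast at this
      omega⟩
    by_cases he : f = e'
    · rw [hk, ← he, hfk]
    · have hinf : f ⊓ e' = e := by
        refine (le_inf hf.le h.le).antisymm' ?_
        by_contra hle
        rcases hef.eq_or_eq (le_inf hf.le h.le) inf_le_left with h' | h'
        · exact hle h'.le
        · rcases h.eq_or_eq hf.le (inf_eq_left.1 h') with h'' | h''
          · exact hf.ne' h''
          · exact he h''
      have h₁ : e' ⋖ f ⊔ e' := covBy_sup_of_inf_covBy_left (hinf.symm ▸ hef)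
      have h₂ : f ⋖ f ⊔ e' := covBy_sup_of_inf_covBy_right (hinf.symm ▸ h)
      rw [ih e' h.lt h₁, ← ih f hf h₂, hk, hfk]

/-- Climbing from ⊥ along a longest chain below x, each cover lowers the coheight by exactly one.
Cancelling coheights then turns the cover formula into one for heights. -/
theorem height_add_coheight (x : M) :
    Order.height x + Order.coheight x = Order.coheight (⊥ : M) := by
  induction x using WellFoundedLT.induction with
  | ind x ih =>
    by_cases hx : x = ⊥
    · simp [hx]
    · obtain ⟨n, hn⟩ := ENat.ne_top_iff_exists.1 (height_ne_top_of_finite x)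
      cases n with
      | zero => exact absurd (isMin_iff_eq_bot.1 (Order.height_eq_zero.1 hn.symm)) hx
      | succ n =>
        obtain ⟨e, he, hen⟩ := (Order.height_eq_coe_add_one_iff.1 hn.symm).2.1
        have hex : e ⋖ x := ⟨he, fun g hg hgx => by
          have h₁ := Order.height_add_one_le hg
          have h₂ := Order.height_add_one_le hgx
          rw [← hn] at h₂
          rw [hen] at h₁
          have := (add_le_add_left h₁ 1).trans h₂
          norm_cast at this
          omega⟩
        rw [← ih e he, coheight_eq_add_one_of_covBy hex, ← hn, hen]
        push_cast
        ring

theorem height_eq_add_one_of_covBy {b c : M} (h : b ⋖ c) :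
    Order.height c = Order.height b + 1 := by
  have hc := height_add_coheight c
  rw [← height_add_coheight b, coheight_eq_add_one_of_covBy h, ← add_assoc, add_right_comm] at hc
  exact WithTop.add_right_cancel (coheight_ne_top_of_finite c) hc

end Semimodular

/-! ## Locally semimodular posets and their blowups -/

/-- A poset with least element in which bounded pairs have joins, the ranks are bounded by `n`,
and every element `x ≠ ⊥` is above an element `a` such that the joins with `a` raise the rank by
one, for all elements below `x` that are not above `a`. -/
structure IsLocallySemimodular (P : Type u) [PartialOrder P] [OrderBot P] (n : ℕ∞) : Prop where
  exists_isLUB {x y z : P} : x ≤ z → y ≤ z → ∃ w, IsLUB {x, y} w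
  height_le (x : P) : Order.height x ≤ n
  exists_join (x : P) : x ≠ ⊥ → ∃ a ≤ x, a ≠ ⊥ ∧ ∀ z ≤ x, ¬ a ≤ z → ∃ w ≤ x, a ≤ w ∧ z ≤ w ∧
    (∀ u ≤ x, a ≤ u → z ≤ u → w ≤ u) ∧ Order.height w = Order.height z + 1

theorem IsLocallySemimodular.exists_isRankedJoin {P : Type u} [PartialOrder P] [OrderBot P]
    {n : ℕ∞} (h : IsLocallySemimodular P n) (x : P) (hx : x ≠ ⊥) : ∃ a J, IsRankedJoin a x J := by
  obtain ⟨a, -, ha, hw⟩ := h.exists_join x hx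
  have : ∀ z, ∃ w, z ≤ x → ¬ a ≤ z → w ≤ x ∧ a ≤ w ∧ z ≤ w ∧
      (∀ u ≤ x, a ≤ u → z ≤ u → w ≤ u) ∧ Order.height w = Order.height z + 1 := fun z => by
    by_cases hz : z ≤ x ∧ ¬ a ≤ z
    · obtain ⟨w, h⟩ := hw z hz.1 hz.2
      exact ⟨w, fun _ _ => h⟩
    · exact ⟨z, fun h h' => absurd ⟨h, h'⟩ hz⟩
  choose J hJ using this
  exact ⟨a, J, fun h => ha (isMin_iff_eq_bot.1 h), fun h h' => (hJ _ h h').1,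
    fun h h' => (hJ _ h h').2.1, fun h h' => (hJ _ h h').2.2.1,
    fun h h' => (hJ _ h h').2.2.2.1 _, fun h h' => (hJ _ h h').2.2.2.2⟩

/-- Take for a any atom below x: if a ≰ z, then a ⊓ z = ⊥ is covered by a, so a ⊔ z covers z. -/
theorem isLocallySemimodular_of_isUpperModularLattice (M : Type u) [Lattice M] [BoundedOrder M]
    [Finite M] [IsUpperModularLattice M] : IsLocallySemimodular M (Order.height (⊤ : M)) where
  exists_isLUB {x y _} _ _ := ⟨x ⊔ y, isLUB_pair⟩
  height_le _ := Order.height_mono le_top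
  exists_join x hx := by
    obtain ⟨a, ha, hax⟩ := (eq_bot_or_exists_atom_le x).resolve_left hx
    refine ⟨a, hax, ha.1, fun z hz haz => ⟨a ⊔ z, sup_le hax hz, le_sup_left, le_sup_right,
      fun u _ => sup_le, height_eq_add_one_of_covBy (covBy_sup_of_inf_covBy_left ?_)⟩⟩
    rw [(ha.le_iff.1 inf_le_left).resolve_right fun e => haz (inf_eq_left.1 e)]
    exact ha.bot_covBy

/-! ### Ranks and joins in a single blowup. -/

section Blowup

variable {L : Type u} [PartialOrder L] {p : L}

theorem Blowup.old_lt_old {x y : L} {hx : ¬ p ≤ x} {hy : ¬ p ≤ y} :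
    old x hx < old y hy ↔ x < y := by
  rw [lt_iff_le_not_ge, lt_iff_le_not_ge]
  rfl

theorem Blowup.new_lt_new {x y : L} {hx : ¬ p ≤ x} {hy : ¬ p ≤ y} {hjx : ∃ z, IsLUB {p, x} z}
    {hjy : ∃ z, IsLUB {p, y} z} : new x hx hjx < new y hy hjy ↔ x < y := by
  rw [lt_iff_le_not_ge, lt_iff_le_not_ge]
  rfl

/-- The elements not above p are downward closed in L, and nothing new lies below their copies. -/
theorem Blowup.height_old [Finite L] (x : L) (hx : ¬ p ≤ x) :
    Order.height (old x hx) = Order.height x := by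
  induction x using WellFoundedLT.induction with
  | ind x ih =>
    refine le_antisymm ?_ ?_
    · rw [Order.height_eq_iSup_lt_height]
      refine iSup₂_le fun b hb => ?_
      cases b with
      | old y hy =>
        rw [ih y (old_lt_old.1 hb) hy]
        exact Order.height_add_one_le (old_lt_old.1 hb)
      | new y hy hj => exact hb.le.elim
    · rw [Order.height_eq_iSup_lt_height]
      refine iSup₂_le fun y hy => ?_
      rw [← ih y hy fun h => hx (h.trans hy.le)]
      exact Order.height_add_one_le (old_lt_old.2 hy)

/-- Strictly below (p, x) lie the old y ≤ x and the (p, y) with y < x; the old x attains the bound.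
-/
theorem Blowup.height_new [Finite L] (x : L) (hx : ¬ p ≤ x) (hj : ∃ z, IsLUB {p, x} z) :
    Order.height (new x hx hj) = Order.height x + 1 := by
  induction x using WellFoundedLT.induction with
  | ind x ih =>
    refine le_antisymm ?_ ?_
    · rw [Order.height_eq_iSup_lt_height]
      refine iSup₂_le fun b hb => add_le_add_left ?_ 1
      cases b with
      | old y hy =>
        rw [height_old]
        exact Order.height_mono (show y ≤ x from hb.le)
      | new y hy hj' =>
        rw [ih y (new_lt_new.1 hb) hy hj']
        exact Order.height_add_one_le (new_lt_new.1 hb)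
    · rw [← height_old x hx]
      exact Order.height_add_one_le ⟨le_refl x, fun h => h.elim⟩

theorem IsLocallySemimodular.exists_isLUB_pair_of_le [OrderBot L] {n : ℕ∞}
    (h : IsLocallySemimodular L n) {x y : L} (hxy : x ≤ y) (hy : ∃ z, IsLUB {p, y} z) :
    ∃ z, IsLUB {p, x} z := by
  obtain ⟨z, hz⟩ := hy
  exact h.exists_isLUB (hz.1 (by simp)) (hxy.trans (hz.1 (by simp)))

/-- Joins are computed on underlying elements of L. The join stays below the bound, so it is not
above p and, if the bound is new, still has a join with p; it is new exactly if one of a, b is. -/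
theorem Blowup.exists_isLUB [OrderBot L] {n : ℕ∞} (h : IsLocallySemimodular L n)
    {a b c : Blowup L p} (hac : a ≤ c) (hbc : b ≤ c) : ∃ w, IsLUB {a, b} w := by
  have key {x y z : L} (hx : x ≤ z) (hy : y ≤ z) : ∃ w ≤ z, x ≤ w ∧ y ≤ w ∧
      ∀ u, x ≤ u → y ≤ u → w ≤ u := by
    obtain ⟨w, hw⟩ := h.exists_isLUB hx hy
    have hxy (u : L) : u ∈ upperBounds {x, y} ↔ x ≤ u ∧ y ≤ u := by simp [upperBounds]
    exact ⟨w, hw.2 ((hxy z).2 ⟨hx, hy⟩), ((hxy w).1 hw.1).1, ((hxy w).1 hw.1).2,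
      fun u h h' => hw.2 ((hxy u).2 ⟨h, h'⟩)⟩
  suffices hs : ∃ w, a ≤ w ∧ b ≤ w ∧ ∀ u, a ≤ u → b ≤ u → w ≤ u by
    obtain ⟨w, h₁, h₂, h₃⟩ := hs
    refine ⟨w, ?_, fun u hu => h₃ u (hu (by simp)) (hu (by simp))⟩
    rintro _ (rfl | rfl)
    exacts [h₁, h₂]
  cases a with
  | old x hx =>
    cases b with
    | old y hy =>
      obtain ⟨z, hz, hxz, hyz⟩ : ∃ z, ¬ p ≤ z ∧ x ≤ z ∧ y ≤ z := by
        cases c with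
        | old z hz => exact ⟨z, hz, hac, hbc⟩
        | new z hz _ => exact ⟨z, hz, hac, hbc⟩
      obtain ⟨w, hw, h₁, h₂, h₃⟩ := key hxz hyz
      refine ⟨old w fun h => hz (h.trans hw), h₁, h₂, fun u hu hu' => ?_⟩
      cases u <;> exact h₃ _ hu hu'
    | new y hy hj =>
      cases c with
      | old z hz => exact hbc.elim
      | new z hz hjz =>
        obtain ⟨w, hw, h₁, h₂, h₃⟩ := key (show x ≤ z from hac) (show y ≤ z from hbc)
        refine ⟨new w (fun h => hz (h.trans hw)) (h.exists_isLUB_pair_of_le hw hjz), h₁, h₂,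
          fun u hu hu' => ?_⟩
        cases u with
        | old u hu₀ => exact hu'.elim
        | new u hu₀ hju => exact h₃ _ hu hu'
  | new x hx hj =>
    cases c with
    | old z hz => exact hac.elim
    | new z hz hjz =>
      -- Once a is new, b enters only through its underlying element y, whether it is old or new.
      obtain ⟨y, hyz, hby, hb⟩ : ∃ y ≤ z, (∀ w hw hj, y ≤ w → b ≤ new w hw hj) ∧
          ∀ u hu hj, b ≤ new u hu hj → y ≤ u := by
        cases b with
        | old y hy => exact ⟨y, hbc, fun _ _ _ h => h, fun _ _ _ h => h⟩
        | new y hy _ => exact ⟨y, hbc, fun _ _ _ h => h, fun _ _ _ h => h⟩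
      obtain ⟨w, hw, h₁, h₂, h₃⟩ := key (show x ≤ z from hac) hyz
      refine ⟨new w (fun h => hz (h.trans hw)) (h.exists_isLUB_pair_of_le hw hjz), h₁,
        hby _ _ _ h₂, fun u hu hu' => ?_⟩
      cases u with
      | old u hu₀ => exact hu.elim
      | new u hu₀ hju => exact h₃ _ hu (hb _ _ _ hu')

theorem IsLocallySemimodular.blowup [OrderBot L] [Finite L] {n : ℕ∞}
    (h : IsLocallySemimodular L n) (hp : p ≠ ⊥) :
    let _ := Blowup.orderBot hp
    IsLocallySemimodular (Blowup L p) n := by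
  let _ := Blowup.orderBot hp
  refine ⟨Blowup.exists_isLUB h, fun b => ?_, fun b hb => ?_⟩
  · cases b with
    | old x hx => exact (Blowup.height_old x hx).trans_le (h.height_le x)
    | new x hx hj =>
      rw [Blowup.height_new]
      obtain ⟨z, hz⟩ := hj
      -- The join z = p ∨ x in L is strictly above x, leaving room for the extra rank of (p, x).
      have hxz : x < z := lt_of_le_of_ne (hz.1 (by simp)) fun e => hx (e ▸ hz.1 (by simp))
      exact (Order.height_add_one_le hxz).trans (h.height_le z)
  · cases b with
    | old x hx =>
      have hx0 : x ≠ ⊥ := by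
        rintro rfl
        exact hb rfl
      obtain ⟨a, hax, ha, hw⟩ := h.exists_join x hx0
      refine ⟨.old a fun h => hx (h.trans hax), hax, fun e => ha (Blowup.old.inj e), ?_⟩
      intro z hz haz
      cases z with
      | new z _ _ => exact hz.elim
      | old z hz0 =>
        obtain ⟨w, hwx, haw, hzw, hmin, hht⟩ := hw z hz haz
        refine ⟨.old w fun h => hx (h.trans hwx), hwx, haw, hzw, fun u hu hau hzu => ?_, ?_⟩
        · cases u with
          | new u _ _ => exact hu.elim
          | old u _ => exact hmin u hu hau hzu
        · rw [Blowup.height_old, Blowup.height_old, hht]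
    | new x hx hj =>
      -- The elements below (p, x) that are not above (p, ⊥) are the old z ≤ x, and the join of such
      -- a z with (p, ⊥) is (p, z).
      refine ⟨Blowup.newAtom hp, bot_le (α := L), fun e => ?_, fun z hz haz => ?_⟩
      · cases e
      · cases z with
        | new z _ _ => exact absurd (bot_le (α := L)) haz
        | old z hz0 =>
          refine ⟨.new z hz0 (h.exists_isLUB_pair_of_le hz hj), hz, bot_le (α := L), le_refl z,
            fun u hu hau hzu => ?_, ?_⟩
          · cases u with
            | old u _ => exact hau.elim
            | new u _ _ => exact hzu
          · rw [Blowup.height_new, Blowup.height_old]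

end Blowup

/-! ### Iterated blowups. -/

theorem isLocallySemimodular_stage_blowup {M : Type u} [PartialOrder M] [OrderBot M] [Finite M]
    (S : BlowupStage M) (q : M) {n : ℕ∞} (h : IsLocallySemimodular S.carrier n) :
    IsLocallySemimodular (S.blowup q).carrier n := by
  unfold BlowupStage.blowup
  split
  · exact h
  · rename_i p _
    let Q (T : BlowupStage M) : Prop := IsLocallySemimodular T.carrier n
    change Q (@dite _ (p = ⊥) (Classical.propDecidable _) _ _)
    by_cases hp : p = ⊥
    · rwa [dif_pos hp]
    · rw [dif_neg hp]
      exact h.blowup hp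

theorem isLocallySemimodular_iterated {M : Type u} [PartialOrder M] [OrderBot M] [Finite M]
    {n : ℕ∞} (h : IsLocallySemimodular M n) (l : List M) :
    IsLocallySemimodular (BlowupStage.iterated l).carrier n := by
  suffices hs : ∀ S : BlowupStage M, IsLocallySemimodular S.carrier n →
      IsLocallySemimodular (l.foldl BlowupStage.blowup S).carrier n from hs _ h
  induction l with
  | nil => exact fun S hS => hS
  | cons q l ih => exact fun S hS => ih _ (isLocallySemimodular_stage_blowup S q hS)

/-! ## The flag resolution on an iterated blowup

Neither the building set nor the structure of the De Concini–Procesi sheaf enters the proof: every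
iterated blowup of `M` is locally semimodular, and the resolution exists for every sheaf on the
opposite of such a poset. -/

theorem mainTheorem7 {M : Type u} [Lattice M] [BoundedOrder M] [Finite M] [IsAtomistic M]
    [IsUpperModularLattice M] (G H : Set M) (hG : IsBuildingSet G)
    (hH : IsPartialBuildingSet G H) (l : List M) (hl : IsBlowupOrder H l) :
    let L : BlowupStage M := BlowupStage.iterated l
    let C : PosetSheaf L.carrierᵒᵈ → CochainComplex (PosetSheaf (IntervalPoset L.carrier)) ℕ :=
      flagTensorComplex L.carrier
    (IsGammaAcyclicResolution (extendByZero (dpSheaf H L)) (C (dpSheaf H L))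
        (augmentation (dpSheaf H L)) ∧
      ∀ j : ℕ, Order.height (⊤ : M) < j → IsZero ((C (dpSheaf H L)).X j)) ∧
    ∀ i : ℕ,
      IsGammaAcyclicResolution (extendByZero (dpSheafPart H L i)) (C (dpSheafPart H L i))
        (augmentation (dpSheafPart H L i)) ∧
      ∀ j : ℕ, Order.height (⊤ : M) < j → IsZero ((C (dpSheafPart H L i)).X j) := by
  intro L C
  have hL : IsLocallySemimodular L.carrier (Order.height (⊤ : M)) :=
    isLocallySemimodular_iterated (isLocallySemimodular_of_isUpperModularLattice M) l
  have key (D : PosetSheaf L.carrierᵒᵈ) :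
      IsGammaAcyclicResolution (extendByZero D) (C D) (augmentation D) ∧
        ∀ j : ℕ, Order.height (⊤ : M) < j → IsZero ((C D).X j) :=
    ⟨isGammaAcyclicResolution_flagTensorComplex D hL.exists_isRankedJoin,
      isZero_flagTensorComplex_X D hL.height_le⟩
  exact ⟨key _, fun i => key _⟩

end
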